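/- Let $p$ be a prime and $R$ a commutative ring with $1$. For finite groups $H,G$, a finite $(H,G)$-biset is called $p$-bifree if the stabilizers in $H$ and in $G$ of all of its elements have order prime to $p$; let $B^\Delta(H,G)$ be the Grothendieck group, with respect to disjoint union, of finite $p$-bifree $(H,G)$-bisets, and $RB^\Delta(H,G)=R\otimes_{\mathbb Z}B^\Delta(H,G)$. Let $R\mathcal C^\Delta$ be the category whose objects are the finite groups, with $\mathrm{Hom}(G,H)=RB^\Delta(H,G)$, with composition induced by $(Y,X)\mapsto Y\times_H X$, and with identities $[G]$. A $p$-bifree biset functor over $R$ is an $R$-linear functor $R\mathcal C^\Delta\to R\text{-Mod}$; these form a category $\mathcal F^\Delta_R$ with natural transformations as morphisms. For a finite group $G$ let $E_G=RB^\Delta(G,G)=\mathrm{End}_{R\mathcal C^\Delta}(G)$, let $I_G=\sum_{|H|<|G|}RB^\Delta(G,H)\circ RB^\Delta(H,G)$, an ideal of $E_G$, and let $\mathcal E^\Delta(G)=E_G/I_G$. Let $\mathrm{Out}(G)=\mathrm{Aut}(G)/\mathrm{Inn}(G)$. (1) For every finite group $G$ there is an isomorphism of $R$-algebras $\mathcal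 E^\Delta(G)\cong R\,\mathrm{Out}(G)$ which, for every $a\in\mathrm{Aut}(G)$, maps the class of the $(G,G)$-biset $G$ with actions $g\cdot x\cdot g'=g\,x\,a(g')$ to the class of $a$ in $\mathrm{Out}(G)$. By means of the isomorphism in (1), regard every $R\,\mathrm{Out}(G)$-module $V$ as an $E_G$-module. Put $L_{G,V}(H)=RB^\Delta(H,G)\otimes_{E_G}V$, let $$J_{G,V}(H)=\Bigl\{\textstyle\sum_i x_i\otimes v_i\in L_{G,V}(H)\ \Big|\ \sum_i (y\circ x_i)v_i=0\ \text{ for all } y\in RB^\Delta(G,H)\Bigr\},$$ and let $S^\Delta_{G,V}=L_{G,V}/J_{G,V}$, which is a $p$-bifree biset functor over $R$. (2) If $G$ is a finite group and $V$ is a simple $R\,\mathrm{Out}(G)$-module, then $S^\Delta_{G,V}$ is a simple object of $\mathcal F^\Delta_R$. (3) Every simple object of $\mathcal F^\Delta_R$ is isomorphic to $S^\Delta_{G,V}$ for some finite group $G$ and some simple $R\,\mathrm{Out}(G)$-module $V$. (4) For finite groups $G,H$, a simple $R\,\mathrm{Out}(G)$-module $V$ and a simple $R\,\mathrm{Out}(H)$-module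 $W$, one has $S^\Delta_{G,V}\cong S^\Delta_{H,W}$ if and only if there are a group isomorphism $f:G\to H$ and an $R$-linear isomorphism $t:V\to W$ such that $t(\alpha v)=f_*(\alpha)\,t(v)$ for all $\alpha\in R\,\mathrm{Out}(G)$ and $v\in V$, where $f_*:R\,\mathrm{Out}(G)\to R\,\mathrm{Out}(H)$ is the algebra isomorphism induced by $a\mapsto f\circ a\circ f^{-1}$. -/

import Mathlib

open CategoryTheory MulOpposite
open scoped TensorProduct

universe u w

namespace PBifree

/-! ### Finite `p`-bifree bisets -/

/-- A finite `p`-bifree `(H, G)`-biset: a finite set with commuting left `H`-action and right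
`G`-action (i.e. left `Gᵐᵒᵖ`-action) such that all the stabilizers in `H` and all the stabilizers
in `G` are `p'`-groups. -/
structure Biset (p : ℕ) (H G : Type u) [Group H] [Group G] : Type (u + 1) where
  carrier : Type u
  [finite : Finite carrier]
  [left : MulAction H carrier]
  [right : MulAction Gᵐᵒᵖ carrier]
  [comm : SMulCommClass H Gᵐᵒᵖ carrier]
  left_stab : ∀ x : carrier, ¬ p ∣ Nat.card (MulAction.stabilizer H x)
  right_stab : ∀ x : carrier, ¬ p ∣ Nat.card (MulAction.stabilizer Gᵐᵒᵖ x)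

attribute [instance] Biset.finite Biset.left Biset.right Biset.comm

/-- Isomorphisms of bisets: bijections commuting with both actions. -/
structure Biset.Iso {p : ℕ} {H G : Type u} [Group H] [Group G] (X Y : Biset p H G) extends
    X.carrier ≃ Y.carrier where
  map_left : ∀ (h : H) (x : X.carrier), toFun (h • x) = h • toFun x
  map_right : ∀ (g : G) (x : X.carrier), toFun (op g • x) = op g • toFun x

section Groups

variable {p : ℕ} {K H G : Type u} [Group K] [Group H] [Group G]

namespace Biset

instance isoSetoid (p : ℕ) (H G : Type u) [Group H] [Group G] : Setoid (Biset p H G) where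
  r X Y := Nonempty (Iso X Y)
  iseqv :=
    { refl := fun X => ⟨⟨Equiv.refl _, fun _ _ => rfl, fun _ _ => rfl⟩⟩
      symm := by
        rintro X Y ⟨f⟩
        refine ⟨⟨f.toEquiv.symm, fun h y => ?_, fun g y => ?_⟩⟩
        · apply f.toEquiv.injective
          have := f.map_left h (f.toEquiv.symm y)
          simp_all
        · apply f.toEquiv.injective
          have := f.map_right g (f.toEquiv.symm y)
          simp_all
      trans := by
        rintro X Y Z ⟨f⟩ ⟨g⟩
        refine ⟨⟨f.toEquiv.trans g.toEquiv, fun h x => ?_, fun h x => ?_⟩⟩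
        · exact (congrArg g.toFun (f.map_left h x)).trans (g.map_left h _)
        · exact (congrArg g.toFun (f.map_right h x)).trans (g.map_right h _) }

/-- The empty biset. -/
def empty (p : ℕ) (H G : Type u) [Group H] [Group G] : Biset p H G :=
  letI : MulAction H PEmpty.{u + 1} :=
    { smul := fun _ x => x, one_smul := fun _ => rfl, mul_smul := fun _ _ _ => rfl }
  letI : MulAction Gᵐᵒᵖ PEmpty.{u + 1} :=
    { smul := fun _ x => x, one_smul := fun _ => rfl, mul_smul := fun _ _ _ => rfl }
  { carrier := PEmpty.{u + 1}
    comm := ⟨fun _ _ x => x.elim⟩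
    left_stab := fun x => x.elim
    right_stab := fun x => x.elim }

/-- The disjoint union of two bisets. -/
def sum (X Y : Biset p H G) : Biset p H G where
  carrier := X.carrier ⊕ Y.carrier
  left_stab := by
    rintro (x | x)
    · rw [show MulAction.stabilizer H (Sum.inl x : X.carrier ⊕ Y.carrier)
        = MulAction.stabilizer H x by ext; simp [MulAction.mem_stabilizer_iff]]
      exact X.left_stab x
    · rw [show MulAction.stabilizer H (Sum.inr x : X.carrier ⊕ Y.carrier)
        = MulAction.stabilizer H x by ext; simp [MulAction.mem_stabilizer_iff]]
      exact Y.left_stab x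
  right_stab := by
    rintro (x | x)
    · rw [show MulAction.stabilizer Gᵐᵒᵖ (Sum.inl x : X.carrier ⊕ Y.carrier)
        = MulAction.stabilizer Gᵐᵒᵖ x by ext; simp [MulAction.mem_stabilizer_iff]]
      exact X.right_stab x
    · rw [show MulAction.stabilizer Gᵐᵒᵖ (Sum.inr x : X.carrier ⊕ Y.carrier)
        = MulAction.stabilizer Gᵐᵒᵖ x by ext; simp [MulAction.mem_stabilizer_iff]]
      exact Y.right_stab x

/-- The `(H, G)`-biset attached to a group isomorphism `f : G ≃* H`: the set `H`, with `H` acting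
by left multiplication and `G` acting on the right by `x · g = x * f g`. -/
def ofIso (p : ℕ) [Fact p.Prime] [Finite H] (f : G ≃* H) : Biset p H G :=
  letI : MulAction Gᵐᵒᵖ H :=
    { smul := fun g x => x * f g.unop
      one_smul := fun x => by change x * f 1 = x; simp
      mul_smul := fun a b x => by
        change x * f (b.unop * a.unop) = x * f b.unop * f a.unop
        simp [mul_assoc] }
  { carrier := H
    comm := ⟨fun a b x => (mul_assoc a x (f b.unop)).symm⟩
    left_stab := fun x => by
      have h : MulAction.stabilizer H x = ⊥ := by
        ext a; simp
      rw [h, Subgroup.card_bot]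
      exact (Fact.out : p.Prime).one_lt.ne' ∘ Nat.dvd_one.mp
    right_stab := fun x => by
      have h : MulAction.stabilizer Gᵐᵒᵖ x = ⊥ := by
        ext a
        rw [MulAction.mem_stabilizer_iff, Subgroup.mem_bot]
        change x * f a.unop = x ↔ _
        simp
      rw [h, Subgroup.card_bot]
      exact (Fact.out : p.Prime).one_lt.ne' ∘ Nat.dvd_one.mp }

/-- The equivalence relation on `Y × X` identifying `(y · h, x)` with `(y, h · x)`. -/
def compSetoid (Y : Biset p K H) (X : Biset p H G) : Setoid (Y.carrier × X.carrier) where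
  r a b := ∃ h : H, a.1 = op h • b.1 ∧ h • a.2 = b.2
  iseqv :=
    { refl := fun a => ⟨1, by simp⟩
      symm := by
        rintro ⟨y, x⟩ ⟨y', x'⟩ ⟨h, h1, h2⟩
        refine ⟨h⁻¹, ?_, ?_⟩
        · simp_all
        · exact inv_smul_eq_iff.mpr h2.symm
      trans := by
        rintro ⟨y, x⟩ ⟨y', x'⟩ ⟨y'', x''⟩ ⟨h, h1, h2⟩ ⟨k, k1, k2⟩
        refine ⟨k * h, ?_, ?_⟩
        · simp_all [mul_smul]
        · simp_all [mul_smul] }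

theorem orderOf_ne_of_smul_eq {A B Y : Type*} [Group A] [Group B] [MulAction A Y] [MulAction B Y]
    [SMulCommClass A B Y] {p m : ℕ} (hp : p.Prime) {a : A} {b : B} {y : Y} (hab : a • y = b • y)
    (hb : b ^ m = 1) (hm : ¬ p ∣ m) (hy : ¬ p ∣ Nat.card (MulAction.stabilizer A y)) :
    orderOf a ≠ p := by
  intro ha
  have key : ∀ n : ℕ, a ^ n • y = b ^ n • y := by
    intro n
    induction n with
    | zero => simp
    | succ n ih => rw [pow_succ, mul_smul, hab, smul_comm, ih, ← mul_smul, ← pow_succ']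
  have hmem : a ^ m ∈ MulAction.stabilizer A y := by
    rw [MulAction.mem_stabilizer_iff, key m, hb, one_smul]
  have h1 : (⟨a ^ m, hmem⟩ : MulAction.stabilizer A y) ^ Nat.card (MulAction.stabilizer A y) = 1 :=
    pow_card_eq_one'
  have h2 : a ^ (m * Nat.card (MulAction.stabilizer A y)) = 1 := by
    have := congrArg Subtype.val h1
    rw [pow_mul]
    simpa using this
  have h3 := orderOf_dvd_of_pow_eq_one h2
  rw [ha] at h3
  rcases hp.dvd_mul.mp h3 with h | h
  · exact hm h
  · exact hy h

/-- The composition `Y ×_H X` of a `(K, H)`-biset `Y` and an `(H, G)`-biset `X`. -/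
def comp [Fact p.Prime] [Finite K] [Finite G] (Y : Biset p K H) (X : Biset p H G) :
    Biset p K G :=
  letI : MulAction K (Quotient (compSetoid Y X)) :=
    { smul := fun k => Quotient.map (fun a => (k • a.1, a.2)) (by
        rintro a b ⟨h, h1, h2⟩
        exact ⟨h, by simp [h1, smul_comm], h2⟩)
      one_smul := by
        rintro ⟨a⟩
        exact congrArg (Quotient.mk _) (Prod.ext (one_smul K a.1) rfl)
      mul_smul := by
        rintro k l ⟨a⟩
        exact congrArg (Quotient.mk _) (Prod.ext (mul_smul k l a.1) rfl) }
  letI : MulAction Gᵐᵒᵖ (Quotient (compSetoid Y X)) :=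
    { smul := fun g => Quotient.map (fun a => (a.1, g • a.2)) (by
        rintro a b ⟨h, h1, h2⟩
        exact ⟨h, h1, by simp [← h2, smul_comm]⟩)
      one_smul := by
        rintro ⟨a⟩
        exact congrArg (Quotient.mk _) (Prod.ext rfl (one_smul Gᵐᵒᵖ a.2))
      mul_smul := by
        rintro k l ⟨a⟩
        exact congrArg (Quotient.mk _) (Prod.ext rfl (mul_smul k l a.2)) }
  { carrier := Quotient (compSetoid Y X)
    comm := ⟨by rintro k g ⟨a⟩; rfl⟩
    left_stab := by
      rintro ⟨y, x⟩ hdvd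
      obtain ⟨⟨k, hk⟩, hord⟩ := exists_prime_orderOf_dvd_card' p hdvd
      rw [Subgroup.orderOf_mk] at hord
      obtain ⟨h, h1, h2⟩ := Quotient.exact (MulAction.mem_stabilizer_iff.mp hk)
      have h3 : (⟨h, h2⟩ : MulAction.stabilizer H x) ^ Nat.card (MulAction.stabilizer H x) = 1 :=
        pow_card_eq_one'
      refine orderOf_ne_of_smul_eq (b := op h) Fact.out h1 ?_ (X.left_stab x) (Y.left_stab y) hord
      rw [← op_pow, op_eq_one_iff]
      simpa using congrArg Subtype.val h3
    right_stab := by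
      rintro ⟨y, x⟩ hdvd
      have : Finite Gᵐᵒᵖ := Finite.of_equiv G opEquiv
      have : SMulCommClass Gᵐᵒᵖ H X.carrier := SMulCommClass.symm _ _ _
      obtain ⟨⟨g, hg⟩, hord⟩ := exists_prime_orderOf_dvd_card' p hdvd
      rw [Subgroup.orderOf_mk] at hord
      obtain ⟨h, h1, h2⟩ := Quotient.exact (MulAction.mem_stabilizer_iff.mp hg)
      have h3 : (⟨op h, h1.symm⟩ : MulAction.stabilizer Hᵐᵒᵖ y) ^
          Nat.card (MulAction.stabilizer Hᵐᵒᵖ y) = 1 := pow_card_eq_one'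
      refine orderOf_ne_of_smul_eq (b := h⁻¹) Fact.out (eq_inv_smul_iff.mpr h2) ?_
        (Y.right_stab y) (X.right_stab x) hord
      rw [inv_pow, inv_eq_one, ← op_eq_one_iff, op_pow]
      simpa using congrArg Subtype.val h3 }

/-! The compatibilities of disjoint union and composition with isomorphisms. -/

theorem sum_congr {X X' Y Y' : Biset p H G} (hX : X ≈ X') (hY : Y ≈ Y') :
    X.sum Y ≈ X'.sum Y' := by
  obtain ⟨f⟩ := hX
  obtain ⟨g⟩ := hY
  refine ⟨⟨Equiv.sumCongr f.toEquiv g.toEquiv, ?_, ?_⟩⟩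
  · rintro h (x | x)
    · exact congrArg Sum.inl (f.map_left h x)
    · exact congrArg Sum.inr (g.map_left h x)
  · rintro h (x | x)
    · exact congrArg Sum.inl (f.map_right h x)
    · exact congrArg Sum.inr (g.map_right h x)

theorem sum_assoc (X Y Z : Biset p H G) : (X.sum Y).sum Z ≈ X.sum (Y.sum Z) :=
  ⟨⟨Equiv.sumAssoc _ _ _, by rintro h ((x | x) | x) <;> rfl,
    by rintro h ((x | x) | x) <;> rfl⟩⟩

theorem sum_comm (X Y : Biset p H G) : X.sum Y ≈ Y.sum X :=
  ⟨⟨Equiv.sumComm _ _, by rintro h (x | x) <;> rfl, by rintro h (x | x) <;> rfl⟩⟩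

theorem empty_sum (X : Biset p H G) : (empty p H G).sum X ≈ X :=
  ⟨⟨Equiv.emptySum PEmpty _, by rintro h (x | x); exacts [x.elim, rfl],
    by rintro h (x | x); exacts [x.elim, rfl]⟩⟩

variable [Fact p.Prime] [Finite K] [Finite G]

theorem comp_congr {Y Y' : Biset p K H} {X X' : Biset p H G} (hY : Y ≈ Y') (hX : X ≈ X') :
    Y.comp X ≈ Y'.comp X' := by
  obtain ⟨g⟩ := hY
  obtain ⟨f⟩ := hX
  refine ⟨⟨Quotient.congr (Equiv.prodCongr g.toEquiv f.toEquiv) ?_, ?_, ?_⟩⟩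
  · rintro ⟨y, x⟩ ⟨y', x'⟩
    have e1 : ∀ h : H, y = op h • y' ↔ g.toEquiv y = op h • g.toEquiv y' := fun h => by
      rw [← g.toEquiv.injective.eq_iff]
      exact Eq.congr_right (g.map_right h y')
    have e2 : ∀ h : H, h • x = x' ↔ h • f.toEquiv x = f.toEquiv x' := fun h => by
      rw [← f.toEquiv.injective.eq_iff]
      exact Eq.congr_left (f.map_left h x)
    exact exists_congr fun h => and_congr (e1 h) (e2 h)
  · rintro k ⟨y, x⟩
    exact congrArg (Quotient.mk _) (Prod.ext (g.map_left k y) rfl)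
  · rintro k ⟨y, x⟩
    exact congrArg (Quotient.mk _) (Prod.ext rfl (f.map_right k x))

theorem empty_comp (X : Biset p H G) : (empty p K H).comp X ≈ empty p K G :=
  haveI : IsEmpty ((empty p K H).comp X).carrier := ⟨by rintro ⟨y, x⟩; exact PEmpty.elim y⟩
  haveI : IsEmpty (empty p K G).carrier := inferInstanceAs (IsEmpty PEmpty)
  ⟨⟨Equiv.equivOfIsEmpty _ _, fun _ x => isEmptyElim x, fun _ x => isEmptyElim x⟩⟩

theorem comp_empty (Y : Biset p K H) : Y.comp (empty p H G) ≈ empty p K G :=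
  haveI : IsEmpty (Y.comp (empty p H G)).carrier := ⟨by rintro ⟨y, x⟩; exact PEmpty.elim x⟩
  haveI : IsEmpty (empty p K G).carrier := inferInstanceAs (IsEmpty PEmpty)
  ⟨⟨Equiv.equivOfIsEmpty _ _, fun _ x => isEmptyElim x, fun _ x => isEmptyElim x⟩⟩

theorem sum_comp (Y Y' : Biset p K H) (X : Biset p H G) :
    (Y.sum Y').comp X ≈ (Y.comp X).sum (Y'.comp X) := by
  refine ⟨⟨⟨?_, ?_, ?_, ?_⟩, ?_, ?_⟩⟩
  · refine Quotient.lift (fun a => Sum.elim (fun y => Sum.inl (Quotient.mk _ (y, a.2)))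
      (fun y => Sum.inr (Quotient.mk _ (y, a.2))) a.1) ?_
    rintro ⟨y | y, x⟩ ⟨y' | y', x'⟩ ⟨h, h1, h2⟩
    · exact congrArg Sum.inl (Quotient.sound ⟨h, Sum.inl_injective h1, h2⟩)
    · exact (Sum.inl_ne_inr h1).elim
    · exact (Sum.inr_ne_inl h1).elim
    · exact congrArg Sum.inr (Quotient.sound ⟨h, Sum.inr_injective h1, h2⟩)
  · refine Sum.elim (Quotient.map (fun a => (Sum.inl a.1, a.2)) ?_)
      (Quotient.map (fun a => (Sum.inr a.1, a.2)) ?_)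
    · rintro a b ⟨h, h1, h2⟩
      exact ⟨h, congrArg Sum.inl h1, h2⟩
    · rintro a b ⟨h, h1, h2⟩
      exact ⟨h, congrArg Sum.inr h1, h2⟩
  · rintro ⟨y | y, x⟩ <;> rfl
  · rintro (⟨y, x⟩ | ⟨y, x⟩) <;> rfl
  · rintro h ⟨y | y, x⟩ <;> rfl
  · rintro h ⟨y | y, x⟩ <;> rfl

theorem comp_sum (Y : Biset p K H) (X X' : Biset p H G) :
    Y.comp (X.sum X') ≈ (Y.comp X).sum (Y.comp X') := by
  refine ⟨⟨⟨?_, ?_, ?_, ?_⟩, ?_, ?_⟩⟩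
  · refine Quotient.lift (fun a => Sum.elim (fun x => Sum.inl (Quotient.mk _ (a.1, x)))
      (fun x => Sum.inr (Quotient.mk _ (a.1, x))) a.2) ?_
    rintro ⟨y, x | x⟩ ⟨y', x' | x'⟩ ⟨h, h1, h2⟩
    · exact congrArg Sum.inl (Quotient.sound ⟨h, h1, Sum.inl_injective h2⟩)
    · exact (Sum.inl_ne_inr h2).elim
    · exact (Sum.inr_ne_inl h2).elim
    · exact congrArg Sum.inr (Quotient.sound ⟨h, h1, Sum.inr_injective h2⟩)
  · refine Sum.elim (Quotient.map (fun a => (a.1, Sum.inl a.2)) ?_)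
      (Quotient.map (fun a => (a.1, Sum.inr a.2)) ?_)
    · rintro a b ⟨h, h1, h2⟩
      exact ⟨h, h1, congrArg Sum.inl h2⟩
    · rintro a b ⟨h, h1, h2⟩
      exact ⟨h, h1, congrArg Sum.inr h2⟩
  · rintro ⟨y, x | x⟩ <;> rfl
  · rintro (⟨y, x⟩ | ⟨y, x⟩) <;> rfl
  · rintro h ⟨y, x | x⟩ <;> rfl
  · rintro h ⟨y, x | x⟩ <;> rfl

variable [Finite H]

theorem comp_assoc {L : Type u} [Group L] [Finite L] (Z : Biset p L K) (Y : Biset p K H)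
    (X : Biset p H G) : (Z.comp Y).comp X ≈ Z.comp (Y.comp X) := by
  refine ⟨⟨⟨?_, ?_, ?_, ?_⟩, ?_, ?_⟩⟩
  · refine Quotient.lift (fun a => Quotient.lift
      (fun b : Z.carrier × Y.carrier => Quotient.mk (compSetoid Z (Y.comp X))
        (b.1, Quotient.mk (compSetoid Y X) (b.2, a.2))) ?_ a.1) ?_
    · rintro ⟨z, y⟩ ⟨z', y'⟩ ⟨k, h1, h2⟩
      exact Quotient.sound ⟨k, h1, congrArg (Quotient.mk _) (Prod.ext h2 rfl)⟩
    · rintro ⟨⟨z, y⟩, x⟩ ⟨⟨z', y'⟩, x'⟩ ⟨h, h1, h2⟩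
      obtain ⟨k, h3, h4⟩ := Quotient.exact h1
      refine Quotient.sound ⟨k, h3, Quotient.sound ⟨h, h4, h2⟩⟩
  · refine Quotient.lift (fun a => Quotient.lift
      (fun b : Y.carrier × X.carrier => Quotient.mk (compSetoid (Z.comp Y) X)
        (Quotient.mk (compSetoid Z Y) (a.1, b.1), b.2)) ?_ a.2) ?_
    · rintro ⟨y, x⟩ ⟨y', x'⟩ ⟨h, h1, h2⟩
      exact Quotient.sound ⟨h, congrArg (Quotient.mk _) (Prod.ext rfl h1), h2⟩
    · rintro ⟨z, ⟨y, x⟩⟩ ⟨z', ⟨y', x'⟩⟩ ⟨k, h1, h2⟩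
      obtain ⟨h, h3, h4⟩ := Quotient.exact h2
      refine Quotient.sound ⟨h, Quotient.sound ⟨k, h1, h3⟩, h4⟩
  · rintro ⟨⟨z, y⟩, x⟩; rfl
  · rintro ⟨z, ⟨y, x⟩⟩; rfl
  · rintro l ⟨⟨z, y⟩, x⟩; rfl
  · rintro l ⟨⟨z, y⟩, x⟩; rfl

theorem ofIso_refl_comp (X : Biset p H G) : (ofIso p (MulEquiv.refl H)).comp X ≈ X := by
  refine ⟨⟨⟨?_, ?_, ?_, ?_⟩, ?_, ?_⟩⟩
  · refine Quotient.lift (fun a : H × X.carrier => a.1 • a.2) ?_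
    rintro ⟨a, x⟩ ⟨b, x'⟩ ⟨h, h1, h2⟩
    change a = HMul.hMul (α := H) (β := H) b h at h1
    change h • x = x' at h2
    change HSMul.hSMul (α := H) a x = HSMul.hSMul (α := H) b x'
    rw [h1, ← h2]
    exact mul_smul (α := H) b h x
  · exact fun x => Quotient.mk _ ((1 : H), x)
  · rintro ⟨a, x⟩
    exact Quotient.sound ⟨a⁻¹, (mul_inv_cancel (G := H) a).symm, inv_smul_smul (G := H) a x⟩
  · exact fun x => one_smul H x
  · rintro h ⟨a, x⟩
    exact mul_smul (α := H) h a x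
  · rintro g ⟨a, x⟩
    exact smul_comm (M := H) a (op g) x

theorem comp_ofIso_refl (X : Biset p H G) : X.comp (ofIso p (MulEquiv.refl G)) ≈ X := by
  refine ⟨⟨⟨?_, ?_, ?_, ?_⟩, ?_, ?_⟩⟩
  · refine Quotient.lift (fun a : X.carrier × G => op a.2 • a.1) ?_
    rintro ⟨x, a⟩ ⟨x', b⟩ ⟨h, h1, h2⟩
    change x = op h • x' at h1
    change HMul.hMul (α := G) (β := G) h a = b at h2
    change op (α := G) a • x = op (α := G) b • x'
    rw [h1, ← h2, ← mul_smul]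
    rfl
  · exact fun x => Quotient.mk _ (x, (1 : G))
  · rintro ⟨x, a⟩
    refine Quotient.sound ⟨a, rfl, mul_one (M := G) a⟩
  · exact fun x => one_smul Gᵐᵒᵖ x
  · rintro h ⟨x, a⟩
    exact (smul_comm h (op (show G from a)) x).symm
  · rintro g ⟨x, a⟩
    exact mul_smul (op g) (op (show G from a)) x

end Biset

/-! ### The Grothendieck group `B^Δ(H, G)` and `R B^Δ(H, G)` -/

variable (p H G) in
/-- The set of isomorphism classes of finite `p`-bifree `(H, G)`-bisets. -/
def BisetClass : Type (u + 1) := Quotient (Biset.isoSetoid p H G)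

/-- The class of isomorphism of a biset. -/
def BisetClass.mk (X : Biset p H G) : BisetClass p H G := Quotient.mk _ X

/-- Isomorphism classes of bisets form a commutative monoid under disjoint union. -/
instance : AddCommMonoid (BisetClass p H G) :=
  letI : Zero (BisetClass p H G) := ⟨.mk (.empty p H G)⟩
  letI : Add (BisetClass p H G) :=
    ⟨Quotient.map₂ Biset.sum fun _ _ h _ _ h' => Biset.sum_congr h h'⟩
  { nsmul := nsmulRec
    add_assoc := by rintro ⟨X⟩ ⟨Y⟩ ⟨Z⟩; exact Quotient.sound (Biset.sum_assoc X Y Z)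
    add_comm := by rintro ⟨X⟩ ⟨Y⟩; exact Quotient.sound (Biset.sum_comm X Y)
    zero_add := by rintro ⟨X⟩; exact Quotient.sound (Biset.empty_sum X)
    add_zero := by
      rintro ⟨X⟩
      exact Quotient.sound (Setoid.trans (Biset.sum_comm X _) (Biset.empty_sum X)) }

/-- The biadditive composition on isomorphism classes. -/
def BisetClass.comp [Fact p.Prime] [Finite K] [Finite H] [Finite G] :
    BisetClass p K H →+ BisetClass p H G →+ BisetClass p K G where
  toFun y :=
    { toFun := fun x => Quotient.map₂ Biset.comp (fun _ _ h _ _ h' => Biset.comp_congr h h') y x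
      map_zero' := by
        obtain ⟨Y⟩ := y
        exact Quotient.sound (Biset.comp_empty Y)
      map_add' := by
        obtain ⟨Y⟩ := y
        rintro ⟨X⟩ ⟨X'⟩
        exact Quotient.sound (Biset.comp_sum Y X X') }
  map_zero' := by
    ext ⟨X⟩
    exact Quotient.sound (Biset.empty_comp X)
  map_add' := by
    rintro ⟨Y⟩ ⟨Y'⟩
    ext ⟨X⟩
    exact Quotient.sound (Biset.sum_comp Y Y' X)

variable (p H G) in
/-- The Grothendieck group `B^Δ(H, G)` of finite `p`-bifree `(H, G)`-bisets. -/
abbrev BurnsideGroup : Type (u + 1) := Algebra.GrothendieckAddGroup (BisetClass p H G)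

namespace BurnsideGroup

/-- The class of a biset in `B^Δ(H, G)`. -/
def mk (X : Biset p H G) : BurnsideGroup p H G := Algebra.GrothendieckAddGroup.of (.mk X)

theorem hom_ext {A : Type*} [AddCommGroup A] {f g : BurnsideGroup p H G →+ A}
    (h : ∀ X : Biset p H G, f (mk X) = g (mk X)) : f = g := by
  apply Algebra.GrothendieckAddGroup.lift.symm.injective
  ext ⟨X⟩
  exact h X

theorem lift_mk {A : Type*} [AddCommGroup A] (f : BisetClass p H G →+ A) (X : Biset p H G) :
    Algebra.GrothendieckAddGroup.lift f (mk X) = f (.mk X) :=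
  DFunLike.congr_fun (Algebra.GrothendieckAddGroup.lift.symm_apply_apply f) (BisetClass.mk X)

variable [Fact p.Prime] [Finite K] [Finite H] [Finite G]

/-- The biadditive composition `B^Δ(K, H) × B^Δ(H, G) → B^Δ(K, G)`. -/
noncomputable def comp :
    BurnsideGroup p K H →+ BurnsideGroup p H G →+ BurnsideGroup p K G :=
  Algebra.GrothendieckAddGroup.lift
    { toFun := fun y => Algebra.GrothendieckAddGroup.lift
        (Algebra.GrothendieckAddGroup.of.comp (BisetClass.comp y))
      map_zero' := hom_ext fun X => by simp [lift_mk]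
      map_add' := fun y y' => hom_ext fun X => by simp [lift_mk] }

theorem comp_mk (Y : Biset p K H) (X : Biset p H G) : comp (mk Y) (mk X) = mk (Y.comp X) := by
  rw [comp, lift_mk]
  exact lift_mk _ X

end BurnsideGroup

variable (R : Type w) [CommRing R]

variable (p H G) in
/-- `R B^Δ(H, G) = R ⊗_ℤ B^Δ(H, G)`. -/
abbrev RB : Type (max (u + 1) w) := R ⊗[ℤ] BurnsideGroup p H G

namespace RB

/-- The class of a biset in `R B^Δ(H, G)`. -/
noncomputable def mk (X : Biset p H G) : RB p H G R := 1 ⊗ₜ BurnsideGroup.mk X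

variable {R} in
theorem hom_ext {A : Type*} [AddCommGroup A] [Module R A] {f g : RB p H G R →ₗ[R] A}
    (h : ∀ X : Biset p H G, f (mk R X) = g (mk R X)) : f = g := by
  have key : (f.toAddMonoidHom.comp
      (TensorProduct.mk ℤ R (BurnsideGroup p H G) 1).toAddMonoidHom) =
      (g.toAddMonoidHom.comp (TensorProduct.mk ℤ R (BurnsideGroup p H G) 1).toAddMonoidHom) :=
    BurnsideGroup.hom_ext h
  ext b
  exact DFunLike.congr_fun key b

theorem mk_eq {X Y : Biset p H G} (h : X ≈ Y) : mk R X = mk R Y := by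
  have : BisetClass.mk X = BisetClass.mk Y := Quotient.sound h
  rw [mk, mk, BurnsideGroup.mk, BurnsideGroup.mk, this]

variable [Fact p.Prime] [Finite K] [Finite H] [Finite G]

/-- The `R`-bilinear composition `R B^Δ(K, H) × R B^Δ(H, G) → R B^Δ(K, G)`. -/
noncomputable def comp : RB p K H R →ₗ[R] RB p H G R →ₗ[R] RB p K G R :=
  LinearMap.liftBaseChange R
    (AddMonoidHom.toIntLinearMap
      { toFun := fun b => (BurnsideGroup.comp b).toIntLinearMap.baseChange R
        map_zero' := hom_ext fun X => by simp [mk]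
        map_add' := fun b b' => hom_ext fun X => by simp [mk, TensorProduct.tmul_add] })

theorem comp_mk (Y : Biset p K H) (X : Biset p H G) :
    comp R (mk R Y) (mk R X) = mk R (Y.comp X) := by
  simp [comp, mk, BurnsideGroup.comp_mk]

theorem comp_assoc {L : Type u} [Group L] [Finite L] (z : RB p L K R) (y : RB p K H R)
    (x : RB p H G R) : comp R (comp R z y) x = comp R z (comp R y x) := by
  have h₁ : ∀ (Z : Biset p L K) (Y : Biset p K H),
      comp R (comp R (mk R Z) (mk R Y)) =
        (comp R (mk R Z)) ∘ₗ (comp R (mk R Y) : RB p H G R →ₗ[R] _) := fun Z Y =>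
    hom_ext fun X => by
      simp only [LinearMap.comp_apply, comp_mk]
      exact mk_eq R (Biset.comp_assoc Z Y X)
  have h₂ : ∀ Z : Biset p L K,
      (comp R).flip x ∘ₗ (comp R (mk R Z) : RB p K H R →ₗ[R] _) =
        comp R (mk R Z) ∘ₗ (comp R).flip x := fun Z =>
    hom_ext fun Y => by
      simpa using DFunLike.congr_fun (h₁ Z Y) x
  have h₃ : (comp R).flip x ∘ₗ (comp R).flip y =
      (comp R (p := p) (K := L)).flip (comp R y x) :=
    hom_ext fun Z => by
      simpa using DFunLike.congr_fun (h₂ Z) y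
  simpa using DFunLike.congr_fun h₃ z

theorem id_comp (x : RB p H G R) : comp R (mk R (.ofIso p (MulEquiv.refl H))) x = x := by
  have h : comp R (mk R (.ofIso p (MulEquiv.refl H))) = (LinearMap.id : RB p H G R →ₗ[R] _) :=
    hom_ext fun X => by
      rw [comp_mk, LinearMap.id_apply]
      exact mk_eq R (Biset.ofIso_refl_comp X)
  rw [h, LinearMap.id_apply]

theorem comp_id (x : RB p H G R) : comp R x (mk R (.ofIso p (MulEquiv.refl G))) = x := by
  have h : (comp R).flip (mk R (.ofIso p (MulEquiv.refl G))) =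
      (LinearMap.id : RB p H G R →ₗ[R] _) :=
    hom_ext fun X => by
      rw [LinearMap.flip_apply, comp_mk, LinearMap.id_apply]
      exact mk_eq R (Biset.comp_ofIso_refl X)
  rw [← LinearMap.flip_apply, h, LinearMap.id_apply]

end RB

end Groups

/-! ### The category of finite groups and `p`-bifree bisets -/

/-- The objects of the category `R C^Δ`: finite groups. -/
structure BisetCat (R : Type w) (p : ℕ) : Type (u + 1) where
  carrier : Type u
  [group : Group carrier]
  [finite : Finite carrier]

attribute [instance] BisetCat.group BisetCat.finite

section Category

variable {R : Type w} [CommRing R] {p : ℕ} [Fact p.Prime]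

/-- The category `R C^Δ`: `Hom(G, H) = R B^Δ(H, G)`, with composition `y ∘ x = y ×_H x` and the
identity of `G` being the class of the biset `G`. -/
noncomputable instance : Category.{max (u + 1) w} (BisetCat.{u, w} R p) where
  Hom G H := RB p H.carrier G.carrier R
  id G := RB.mk R (.ofIso p (MulEquiv.refl G.carrier))
  comp x y := RB.comp R y x
  id_comp x := RB.comp_id R x
  comp_id x := RB.id_comp R x
  assoc x y z := (RB.comp_assoc R z y x).symm

noncomputable instance : Preadditive (BisetCat.{u, w} R p) where
  homGroup G H := inferInstanceAs (AddCommGroup (RB p H.carrier G.carrier R))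
  add_comp _ _ _ x x' y := (RB.comp R y).map_add x x'
  comp_add _ _ _ x y y' := LinearMap.map_add₂ (RB.comp R) y y' x

noncomputable instance : Linear R (BisetCat.{u, w} R p) where
  homModule G H := inferInstanceAs (Module R (RB p H.carrier G.carrier R))
  smul_comp _ _ _ r x y := (RB.comp R y).map_smul r x
  comp_smul _ _ _ x r y := LinearMap.map_smul₂ (RB.comp R) r y x

/-- The morphism `G ⟶ H` of `R C^Δ` given by a `p`-bifree `(H, G)`-biset. -/
noncomputable def BisetCat.homOfBiset {G H : BisetCat.{u, w} R p}
    (X : Biset p H.carrier G.carrier) : G ⟶ H := RB.mk R X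

/-! ### The essential algebra and the outer automorphism group -/

/-- The ideal `I_G = ∑_{|H| < |G|} R B^Δ(G, H) ∘ R B^Δ(H, G)` of `End(G) = R B^Δ(G, G)`. -/
noncomputable def essentialIdeal (G : BisetCat.{u, w} R p) : Ideal (End G) where
  __ := (Submodule.span R {f : End G | ∃ (H : BisetCat.{u, w} R p) (x : G ⟶ H) (y : H ⟶ G),
    Nat.card H.carrier < Nat.card G.carrier ∧ f = x ≫ y}).toAddSubmonoid
  smul_mem' c f hf := by
    refine Submodule.span_induction (p := fun f _ => c • f ∈ Submodule.span R _) ?_ ?_ ?_ ?_ hf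
    · rintro _ ⟨H, x, y, h, rfl⟩
      exact Submodule.subset_span ⟨H, x, y ≫ c, h, Category.assoc x y c⟩
    · simp
    · intro a b _ _ ha hb
      rw [smul_add]
      exact add_mem ha hb
    · intro r a _ ha
      rw [smul_comm]
      exact Submodule.smul_mem _ r ha

instance (G : BisetCat.{u, w} R p) : (essentialIdeal G).IsTwoSided where
  mul_mem_of_left {f} c hf := by
    refine Submodule.span_induction (p := fun f _ => f * c ∈ Submodule.span R _) ?_ ?_ ?_ ?_ hf
    · rintro _ ⟨H, x, y, h, rfl⟩
      exact Submodule.subset_span ⟨H, c ≫ x, y, h, (Category.assoc c x y).symm⟩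
    · simp
    · intro a b _ _ ha hb
      rw [add_mul]
      exact add_mem ha hb
    · intro r a _ ha
      rw [smul_mul_assoc]
      exact Submodule.smul_mem _ r ha

/-- The essential algebra `E^Δ(G) = R B^Δ(G, G) / I_G`. -/
abbrev EssentialAlgebra (G : BisetCat.{u, w} R p) : Type (max (u + 1) w) :=
  End G ⧸ essentialIdeal G

end Category

instance innNormal (G : Type u) [Group G] : (MulAut.conj (G := G)).range.Normal where
  conj_mem := by
    rintro _ ⟨g, rfl⟩ a
    exact ⟨a g, by ext x; simp⟩

/-- The group `Out(G) = Aut(G) / Inn(G)`. -/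
abbrev Out (G : Type u) [Group G] : Type u := MulAut G ⧸ (MulAut.conj (G := G)).range

/-- The isomorphism `Out(G) ≃ Out(H)`, `[a] ↦ [f ∘ a ∘ f⁻¹]` induced by `f : G ≃* H`. -/
def outCongr {G H : Type u} [Group G] [Group H] (f : G ≃* H) : Out G ≃* Out H :=
  QuotientGroup.congr _ _ (MulAut.congr f) (by
    ext a
    constructor
    · rintro ⟨_, ⟨g, rfl⟩, rfl⟩
      exact ⟨f g, by ext x; simp⟩
    · rintro ⟨h, rfl⟩
      exact ⟨MulAut.conj (f.symm h), ⟨_, rfl⟩, by ext x; simp⟩)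

/-! ### `p`-bifree biset functors -/

section Functors

variable (R : Type w) [CommRing R] (p : ℕ) [Fact p.Prime]

/-- The category of `p`-bifree biset functors over `R`: the `R`-linear functors from `R C^Δ` to
`R`-modules, with natural transformations. -/
abbrev BisetFunctor :=
  ObjectProperty.FullSubcategory
    (fun F : BisetCat.{u, w} R p ⥤ ModuleCat.{max (u + 1) w} R => F.Additive ∧ F.Linear R)

end Functors

section Simple

variable {R : Type w} [CommRing R] {p : ℕ} [Fact p.Prime]

/-! Below, an `End(G)`-module `V` is an `R`-module `V` with an algebra morphism
`ρ : End(G) → End_R(V)`. -/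

variable (G : BisetCat.{u, w} R p) {V : Type (max (u + 1) w)} [AddCommGroup V] [Module R V]
  (ρ : End G →ₐ[R] Module.End R V)

/-- The relations `(x ∘ e) ⊗ v = x ⊗ e v`, for `e ∈ End(G)`, in `R B^Δ(H, G) ⊗_R V`. -/
noncomputable def balancedRel (H : BisetCat.{u, w} R p) : Submodule R ((G ⟶ H) ⊗[R] V) :=
  Submodule.span R
    {z | ∃ (x : G ⟶ H) (e : End G) (v : V), z = (e.asHom ≫ x) ⊗ₜ v - x ⊗ₜ (ρ e v)}

/-- The functor `L_{G,V}`, with `L_{G,V}(H) = R B^Δ(H, G) ⊗_{End(G)} V`. -/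
noncomputable def functorL : BisetCat.{u, w} R p ⥤ ModuleCat.{max (u + 1) w} R where
  obj H := ModuleCat.of R (((G ⟶ H) ⊗[R] V) ⧸ balancedRel G ρ H)
  map {H K} f := ModuleCat.ofHom <|
    (balancedRel G ρ H).mapQ (balancedRel G ρ K) ((Linear.rightComp R G f).rTensor V) (by
      rw [balancedRel, Submodule.span_le]
      rintro _ ⟨x, e, v, rfl⟩
      refine Submodule.subset_span ⟨x ≫ f, e, v, ?_⟩
      simp)
  map_id H := by
    apply ModuleCat.hom_ext
    apply Submodule.linearMap_qext
    apply TensorProduct.ext'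
    intro x v
    simp
  map_comp f g := by
    apply ModuleCat.hom_ext
    apply Submodule.linearMap_qext
    apply TensorProduct.ext'
    intro x v
    simp

/-- For `y ∈ R B^Δ(G, H)`, the map `L_{G,V}(H) → V`, `x ⊗ v ↦ (y ∘ x) v`. -/
noncomputable def evalL {H : BisetCat.{u, w} R p} (y : H ⟶ G) :
    (functorL G ρ).obj H →ₗ[R] V :=
  (balancedRel G ρ H).liftQ
    (TensorProduct.lift
      { toFun := fun x => ρ (x ≫ y : G ⟶ G)
        map_add' := fun x x' => by rw [Preadditive.add_comp]; exact map_add ρ _ _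
        map_smul' := fun r x => by rw [Linear.smul_comp]; exact map_smul ρ r _ }) (by
      rw [balancedRel, Submodule.span_le]
      rintro _ ⟨x, e, v, rfl⟩
      have h : ρ ((e.asHom ≫ x) ≫ y : G ⟶ G) = ρ (x ≫ y : G ⟶ G) * ρ e := by
        rw [Category.assoc]
        exact map_mul ρ (show End G from x ≫ y) e
      change TensorProduct.lift _ _ = 0
      rw [map_sub, TensorProduct.lift.tmul, TensorProduct.lift.tmul, sub_eq_zero]
      exact DFunLike.congr_fun h v)

theorem evalL_map {H K : BisetCat.{u, w} R p} (f : H ⟶ K) (y : K ⟶ G)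
    (z : (functorL G ρ).obj H) :
    evalL G ρ y ((functorL G ρ).map f z) = evalL G ρ (f ≫ y) z := by
  have h : evalL G ρ y ∘ₗ ((functorL G ρ).map f).hom = evalL G ρ (f ≫ y) := by
    apply Submodule.linearMap_qext
    apply TensorProduct.ext'
    intro x v
    exact congrArg (fun e : G ⟶ G => ρ e v) (Category.assoc x f y)
  exact DFunLike.congr_fun h z

/-- The subfunctor `J_{G,V}` of `L_{G,V}`: the elements `∑ xᵢ ⊗ vᵢ` of `L_{G,V}(H)` such that
`∑ (y ∘ xᵢ) vᵢ = 0` for all `y ∈ R B^Δ(G, H)`. -/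
noncomputable def subJ (H : BisetCat.{u, w} R p) : Submodule R ((functorL G ρ).obj H) :=
  ⨅ y : H ⟶ G, LinearMap.ker (evalL G ρ y)

/-- The functor `L_{G,V} / J_{G,V}`. -/
noncomputable def functorLJ : BisetCat.{u, w} R p ⥤ ModuleCat.{max (u + 1) w} R where
  obj H := ModuleCat.of R ((functorL G ρ).obj H ⧸ subJ G ρ H)
  map {H K} f := ModuleCat.ofHom <|
    (subJ G ρ H).mapQ (subJ G ρ K) ((functorL G ρ).map f).hom (by
      intro z hz
      simp only [subJ, Submodule.mem_comap, Submodule.mem_iInf, LinearMap.mem_ker] at hz ⊢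
      exact fun y => (evalL_map G ρ f y z).trans (hz _))
  map_id H := by
    apply ModuleCat.hom_ext
    apply Submodule.linearMap_qext
    ext z
    simp
  map_comp f g := by
    apply ModuleCat.hom_ext
    apply Submodule.linearMap_qext
    ext z
    simp

theorem functorL_map_add {H K : BisetCat.{u, w} R p} (f g : H ⟶ K) :
    (functorL G ρ).map (f + g) = (functorL G ρ).map f + (functorL G ρ).map g := by
  apply ModuleCat.hom_ext
  apply Submodule.linearMap_qext
  apply TensorProduct.ext'
  intro x v
  refine congrArg (balancedRel G ρ K).mkQ (?_ : (x ≫ (f + g)) ⊗ₜ[R] v = _ ⊗ₜ v + _ ⊗ₜ v)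
  rw [Preadditive.comp_add, TensorProduct.add_tmul]
  rfl

theorem functorL_map_smul {H K : BisetCat.{u, w} R p} (f : H ⟶ K) (r : R) :
    (functorL G ρ).map (r • f) = r • (functorL G ρ).map f := by
  apply ModuleCat.hom_ext
  apply Submodule.linearMap_qext
  apply TensorProduct.ext'
  intro x v
  refine congrArg (balancedRel G ρ K).mkQ (?_ : (x ≫ (r • f)) ⊗ₜ[R] v = r • (_ ⊗ₜ v))
  rw [Linear.comp_smul, TensorProduct.smul_tmul']
  rfl

/-- The `p`-bifree biset functor `S^Δ_{G,V} = L_{G,V} / J_{G,V}`. -/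
noncomputable def functorS : BisetFunctor.{u, w} R p where
  obj := functorLJ G ρ
  property := by
    refine ⟨⟨fun {H K f g} => ?_⟩, ⟨fun {H K} f r => ?_⟩⟩
    · apply ModuleCat.hom_ext
      apply Submodule.linearMap_qext
      ext z
      exact congrArg (fun h => (subJ G ρ K).mkQ (h.hom z)) (functorL_map_add G ρ f g)
    · apply ModuleCat.hom_ext
      apply Submodule.linearMap_qext
      ext z
      exact congrArg (fun h => (subJ G ρ K).mkQ (h.hom z)) (functorL_map_smul G ρ f r)

variable {G} in
/-- An `R Out(G)`-module `V`, viewed as a module for `End(G) = R B^Δ(G, G)` through the projection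
onto the essential algebra, followed by an isomorphism `e` of the essential algebra with
`R Out(G)`. -/
noncomputable def inflate (e : EssentialAlgebra G ≃ₐ[R] MonoidAlgebra R (Out G.carrier))
    (V : Type (max (u + 1) w)) [AddCommGroup V] [Module R V]
    [Module (MonoidAlgebra R (Out G.carrier)) V]
    [IsScalarTower R (MonoidAlgebra R (Out G.carrier)) V] : End G →ₐ[R] Module.End R V :=
  (Algebra.lsmul R R V).comp
    (e.toAlgHom.comp (Ideal.Quotient.mkₐ R (essentialIdeal G)))

end Simple

end PBifree

/-! ### Transitive bisets and their factorizations. -/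

namespace PBifree

namespace Biset

variable {p : ℕ} {K H G : Type u} [Group K] [Group H] [Group G]

/-! Let `X` be a transitive `(H, G)`-biset with base point `x` and `|G| = |H|`. Let `P` be the set
of `g` for which `x g` lies in the left orbit `H x`, and let `N` be the right stabilizer of `x`. If
`P` is proper, `X` is obtained from `H x` by inducing from `P` to `G`, so it factors through `P`. If
`P = G`, then `N` is normal and acts trivially on `X`, so `X` factors through `G ⧸ N`; the deflation
biset is allowed because `p`-bifreeness makes `|N|` prime to `p`. If `P = G` and `N = 1`, counting
shows that `X` comes from an isomorphism `G ≃* H` (`factors_or_exists_ofIso_equiv`). Thus morphisms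
between groups of equal order are spanned by isomorphisms modulo those factoring through smaller
groups, and `R Out(G)` maps onto the essential algebra.

Injectivity comes from a linear retraction, `Biset.twistSum`. On each free left orbit where the
right action has the form `x g = a(g) x` with `a` an automorphism, record the class of `a` in
`Out(G)`, and add up. This vanishes on composites through a smaller group and returns the class of
`a` on the biset of `a`. Being only a linear left inverse is enough, so its multiplicativity is
never needed.

The classification rests on evaluation at `G`. One has `S_{G,V}(G) ≅ V`; the functor is generated by
this value, and each nonzero element is detected by some morphism to `G`. Hence simplicity of `V`
gives simplicity of `S_{G,V}`. Conversely, for simple `F` take `G` of least order with `F(G) ≠ 0`: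
then `I_G` kills `F(G)`, which is a simple `R Out(G)`-module, and `x ⊗ v ↦ F(x)(v)` is an
isomorphism onto `F` (`FunctorS.nonempty_iso`). Finally, `S_{G,V}` vanishes on groups smaller than
`G` and on groups of order `|G|` not isomorphic to `G`, so it determines `G`, and its value there
determines `V`. -/

theorem not_dvd_card_of_dvd {p m n : ℕ} (h : m ∣ n) (hn : ¬ p ∣ n) : ¬ p ∣ m :=
  fun hm => hn (hm.trans h)

/-- The sub-biset carried by a subset stable under both actions. -/
def sub (X : Biset p H G) (S : Set X.carrier) (hl : ∀ (h : H), ∀ x ∈ S, h • x ∈ S)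
    (hr : ∀ (g : G), ∀ x ∈ S, op g • x ∈ S) : Biset p H G :=
  letI : MulAction H S :=
    { smul := fun h x => ⟨h • x.1, hl h x.1 x.2⟩
      one_smul := fun x => Subtype.ext (one_smul H x.1)
      mul_smul := fun a b x => Subtype.ext (mul_smul a b x.1) }
  letI : MulAction Gᵐᵒᵖ S :=
    { smul := fun g x => ⟨g • x.1, hr g.unop x.1 x.2⟩
      one_smul := fun x => Subtype.ext (one_smul Gᵐᵒᵖ x.1)
      mul_smul := fun a b x => Subtype.ext (mul_smul a b x.1) }
  { carrier := S
    comm := ⟨fun h g x => Subtype.ext (smul_comm h g x.1)⟩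
    left_stab := fun x => by
      rw [show MulAction.stabilizer H x = MulAction.stabilizer H x.1 from
        Subgroup.ext fun _ => Subtype.ext_iff]
      exact X.left_stab x.1
    right_stab := fun x => by
      rw [show MulAction.stabilizer Gᵐᵒᵖ x = MulAction.stabilizer Gᵐᵒᵖ x.1 from
        Subgroup.ext fun _ => Subtype.ext_iff]
      exact X.right_stab x.1 }

/-- A biset is the disjoint union of a stable subset and its complement. -/
theorem sub_sum_sub_compl (X : Biset p H G) (S : Set X.carrier)
    (hl : ∀ (h : H), ∀ x ∈ S, h • x ∈ S) (hr : ∀ (g : G), ∀ x ∈ S, op g • x ∈ S)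
    (hl' : ∀ (h : H), ∀ x ∈ Sᶜ, h • x ∈ Sᶜ) (hr' : ∀ (g : G), ∀ x ∈ Sᶜ, op g • x ∈ Sᶜ) :
    (X.sub S hl hr).sum (X.sub Sᶜ hl' hr') ≈ X := by
  classical
  refine ⟨⟨Equiv.Set.sumCompl S, ?_, ?_⟩⟩
  · rintro h (x | x) <;> rfl
  · rintro g (x | x) <;> rfl

/-- The restriction of the right action to a subgroup. -/
def resRight (X : Biset p H G) (P : Subgroup G) : Biset p H P :=
  letI : MulAction (P : Type u)ᵐᵒᵖ X.carrier := MulAction.compHom X.carrier P.subtype.op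
  { carrier := X.carrier
    comm := ⟨fun h q x => smul_comm h (op (q.unop : G)) x⟩
    left_stab := X.left_stab
    right_stab := fun x => by
      refine not_dvd_card_of_dvd ?_ (X.right_stab x)
      let φ : MulAction.stabilizer (P : Type u)ᵐᵒᵖ x →* MulAction.stabilizer Gᵐᵒᵖ x :=
        (P.subtype.op.comp (Subgroup.subtype _)).codRestrict _ fun q => q.2
      refine Subgroup.card_dvd_of_injective φ fun a b hab => ?_
      have h : op ((a.1.unop : P) : G) = op ((b.1.unop : P) : G) := congrArg Subtype.val hab
      exact Subtype.ext (unop_injective (Subtype.ext (op_injective h))) }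

/-- The right action of `G ⧸ N` on a biset on which the normal subgroup `N` acts trivially. -/
def descRight (X : Biset p H G) (N : Subgroup G) [N.Normal]
    (hN : ∀ n ∈ N, ∀ x : X.carrier, op n • x = x) : Biset p H (G ⧸ N) :=
  letI : MulAction (G ⧸ N)ᵐᵒᵖ X.carrier :=
    { smul := fun q x => Quotient.liftOn' q.unop (fun g => op g • x) (fun a b hab => by
        have h := hN _ (QuotientGroup.leftRel_apply.mp hab)
        have h2 := h (op a • x)
        rw [← mul_smul, ← op_mul, mul_inv_cancel_left] at h2
        exact h2.symm)
      one_smul := fun x => one_smul Gᵐᵒᵖ x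
      mul_smul := by
        intro a b x
        induction a using MulOpposite.rec' with | _ a
        induction b using MulOpposite.rec' with | _ b
        obtain ⟨a, rfl⟩ := QuotientGroup.mk_surjective a
        obtain ⟨b, rfl⟩ := QuotientGroup.mk_surjective b
        exact mul_smul (op a) (op b) x }
  { carrier := X.carrier
    comm := ⟨by
      intro h q x
      induction q using MulOpposite.rec' with | _ q
      obtain ⟨q, rfl⟩ := QuotientGroup.mk_surjective q
      exact smul_comm h (op q) x⟩
    left_stab := X.left_stab
    right_stab := fun x => by
      refine not_dvd_card_of_dvd ?_ (X.right_stab x)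
      let φ : MulAction.stabilizer Gᵐᵒᵖ x →* MulAction.stabilizer (G ⧸ N)ᵐᵒᵖ x :=
        ((QuotientGroup.mk' N).op.comp (Subgroup.subtype _)).codRestrict _ fun q => q.2
      refine Subgroup.card_dvd_of_surjective φ ?_
      rintro ⟨q, hq⟩
      induction q using MulOpposite.rec' with | _ q
      obtain ⟨q, rfl⟩ := QuotientGroup.mk_surjective q
      exact ⟨⟨op q, hq⟩, rfl⟩ }

/-- The group `G` as a `(P, G)`-biset, for a subgroup `P` of `G`. -/
def restriction (p : ℕ) [Fact p.Prime] [Finite G] (P : Subgroup G) : Biset p P G where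
  carrier := G
  comm := ⟨fun a b x => (mul_assoc (a : G) x b.unop).symm⟩
  left_stab := fun x => by
    have h : MulAction.stabilizer P x = ⊥ := by
      ext a
      rw [MulAction.mem_stabilizer_iff, Subgroup.mem_bot, Subgroup.smul_def, smul_eq_mul,
        mul_eq_right, OneMemClass.coe_eq_one]
    rw [h, Subgroup.card_bot]
    exact (Fact.out : p.Prime).one_lt.ne' ∘ Nat.dvd_one.mp
  right_stab := (ofIso p (MulEquiv.refl G)).right_stab

/-- The quotient group `G ⧸ N` as a `(G ⧸ N, G)`-biset, for a normal subgroup `N` of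
order prime to `p`. -/
def deflation (p : ℕ) [Fact p.Prime] [Finite G] (N : Subgroup G) [N.Normal]
    (hN : ¬ p ∣ Nat.card N) : Biset p (G ⧸ N) G :=
  letI : MulAction Gᵐᵒᵖ (G ⧸ N) := MulAction.compHom (G ⧸ N) (QuotientGroup.mk' N).op
  { carrier := G ⧸ N
    comm := ⟨fun a b x => (mul_assoc a x (b.unop : G ⧸ N)).symm⟩
    left_stab := (ofIso p (MulEquiv.refl (G ⧸ N))).left_stab
    right_stab := fun x => by
      refine not_dvd_card_of_dvd ?_ hN
      -- Normality makes the right stabilizer of every point of `G ⧸ N` equal to `N`; this is the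
      -- only place where `|N|` must be prime to `p`.
      refine dvd_of_eq (Nat.card_congr (Equiv.subtypeEquiv opEquiv.symm fun a => ?_))
      rw [MulAction.mem_stabilizer_iff]
      change x * (a.unop : G ⧸ N) = x ↔ a.unop ∈ N
      rw [mul_eq_left, QuotientGroup.eq_one_iff] }

/-- A balanced, surjective map on a product identifies a composition of bisets. -/
theorem comp_equiv_of_balanced [Fact p.Prime] [Finite K] [Finite G] {Y : Biset p K H}
    {Z : Biset p H G} {X : Biset p K G} (m : Y.carrier → Z.carrier → X.carrier)
    (hl : ∀ (k : K) y z, m (k • y) z = k • m y z)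
    (hr : ∀ (g : G) y z, m y (op g • z) = op g • m y z)
    (hs : ∀ x, ∃ y z, m y z = x)
    (hm : ∀ y z y' z', m y z = m y' z' ↔ ∃ h : H, y = op h • y' ∧ h • z = z') :
    Y.comp Z ≈ X := by
  refine ⟨⟨Equiv.ofBijective (Quotient.lift (fun a => m a.1 a.2)
    fun a b hab => (hm _ _ _ _).mpr hab) ⟨?_, ?_⟩, ?_, ?_⟩⟩
  · rintro ⟨a⟩ ⟨b⟩ hab
    exact Quotient.sound ((hm _ _ _ _).mp hab)
  · intro x
    obtain ⟨y, z, h⟩ := hs x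
    exact ⟨Quotient.mk _ (y, z), h⟩
  · rintro k ⟨y, z⟩
    exact hl k y z
  · rintro g ⟨y, z⟩
    exact hr g y z

/-- The elements of `G` whose right action on `x` agrees with the left action of an element
of `H`. -/
def rightSupport (X : Biset p H G) (x : X.carrier) : Subgroup G where
  carrier := {g | ∃ h : H, h • x = op g • x}
  one_mem' := ⟨1, by simp⟩
  mul_mem' := by
    rintro a b ⟨h, hh⟩ ⟨k, hk⟩
    exact ⟨h * k, by rw [mul_smul, hk, smul_comm, hh, op_mul, mul_smul]⟩
  inv_mem' := by
    rintro a ⟨h, hh⟩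
    refine ⟨h⁻¹, ?_⟩
    rw [inv_smul_eq_iff, smul_comm, hh, MulOpposite.op_inv, inv_smul_smul]

/-- The stabilizer of `x` for the right action, as a subgroup of `G`. -/
def rightStab (X : Biset p H G) (x : X.carrier) : Subgroup G where
  carrier := {g | op g • x = x}
  one_mem' := by simp
  mul_mem' := by
    intro a b ha hb
    change op (a * b) • x = x
    rw [op_mul, mul_smul, show op a • x = x from ha, show op b • x = x from hb]
  inv_mem' := by
    intro a ha
    change op a⁻¹ • x = x
    rw [MulOpposite.op_inv, inv_smul_eq_iff, show op a • x = x from ha]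

theorem not_dvd_card_rightStab (X : Biset p H G) (x : X.carrier) :
    ¬ p ∣ Nat.card (X.rightStab x) := by
  have h : Nat.card (X.rightStab x) = Nat.card (MulAction.stabilizer Gᵐᵒᵖ x) :=
    Nat.card_congr (Equiv.subtypeEquiv opEquiv fun a => Iff.rfl)
  rw [h]
  exact X.right_stab x

section Transitive

variable {X : Biset p H G} {x : X.carrier}

theorem rightStab_normal (hP : X.rightSupport x = ⊤) : (X.rightStab x).Normal where
  conj_mem n hn g := by
    obtain ⟨h, hh⟩ : g ∈ X.rightSupport x := hP ▸ Subgroup.mem_top g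
    change op (g * n * g⁻¹) • x = x
    rw [op_mul, op_mul, mul_smul, mul_smul, MulOpposite.op_inv, inv_smul_eq_iff, ← hh,
      ← smul_comm h, show op n • x = x from hn]

theorem exists_smul_eq_of_rightSupport_eq_top (hx : ∀ y, ∃ (h : H) (g : G), y = h • op g • x)
    (hP : X.rightSupport x = ⊤) (y : X.carrier) : ∃ h : H, h • x = y := by
  obtain ⟨h, g, rfl⟩ := hx y
  obtain ⟨k, hk⟩ : g ∈ X.rightSupport x := hP ▸ Subgroup.mem_top g
  exact ⟨h * k, by rw [mul_smul, hk]⟩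

variable [Fact p.Prime] [Finite H]

/-- Choose `σ g` with `σ g • x = x g`. Trivial right stabilizer makes `σ` injective, equality of
orders makes it bijective, and only then does the left stabilizer turn out to be trivial, which
forces `σ` to be a homomorphism. -/
theorem exists_ofIso_equiv (hc : Nat.card G = Nat.card H)
    (hx : ∀ y, ∃ (h : H) (g : G), y = h • op g • x)
    (hP : X.rightSupport x = ⊤) (hN : X.rightStab x = ⊥) : ∃ f : G ≃* H, ofIso p f ≈ X := by
  have hex : ∀ g : G, ∃ h : H, h • x = op g • x := fun g =>
    (hP ▸ Subgroup.mem_top g : g ∈ X.rightSupport x)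
  choose σ hσ using hex
  have hfix : ∀ g : G, op g • x = x → g = 1 := fun g hg => by
    have : g ∈ X.rightStab x := hg
    rwa [hN, Subgroup.mem_bot] at this
  have hinj : Function.Injective σ := fun a b hab => by
    have h : op a • x = op b • x := by rw [← hσ, ← hσ, hab]
    have := hfix (a * b⁻¹) (by rw [op_mul, mul_smul, h, MulOpposite.op_inv, inv_smul_smul])
    exact mul_inv_eq_one.mp this
  have hbij : Function.Bijective σ := (Nat.bijective_iff_injective_and_card σ).mpr ⟨hinj, hc⟩
  -- The choice of `σ 1` could be any element fixing `x`. The preimage of `1` under `σ` fixes `x` on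
  -- the right, so that preimage is `1`.
  have hone : σ 1 = 1 := by
    obtain ⟨g, hg⟩ := hbij.2 1
    have := hσ g
    rw [hg, one_smul] at this
    rw [← hfix g this.symm, hg]
  have hfree : ∀ h : H, h • x = x → h = 1 := fun h hh => by
    obtain ⟨g, rfl⟩ := hbij.2 h
    rw [hfix g ((hσ g).symm.trans hh), hone]
  have hfree' : ∀ a b : H, a • x = b • x → a = b := fun a b hab => by
    have := hfree (b⁻¹ * a) (by rw [mul_smul, hab, inv_smul_smul])
    exact (inv_mul_eq_one.mp this).symm
  let f : G ≃* H :=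
    { Equiv.ofBijective σ hbij with
      map_mul' := fun a b => hfree' _ _ (by
        change σ (a * b) • x = (σ a * σ b) • x
        rw [hσ, mul_smul, hσ b, smul_comm, hσ a, op_mul, mul_smul]) }
  refine ⟨f, ⟨⟨Equiv.ofBijective (fun h : H => h • x) ⟨fun a b => hfree' a b, fun y =>
    exists_smul_eq_of_rightSupport_eq_top hx hP y⟩, ?_, ?_⟩⟩⟩
  · exact fun h k => mul_smul (α := H) h k x
  · intro g (k : H)
    have h := (mul_smul k (σ g) x).trans ((congrArg (k • ·) (hσ g)).trans (smul_comm k (op g) x))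
    exact h

variable [Finite G]

/-- The left orbit of `x` is stable under right multiplication by its right support `P`, and `(H x)
×_P G → X`, `(y, g) ↦ y g`, is bijective. -/
theorem exists_comp_restriction (hx : ∀ y, ∃ (h : H) (g : G), y = h • op g • x) :
    ∃ Y : Biset p H (X.rightSupport x), Y.comp (restriction p (X.rightSupport x)) ≈ X := by
  have hr : ∀ (q : X.rightSupport x), ∀ y ∈ MulAction.orbit H x,
      op (q : G) • y ∈ MulAction.orbit H x := by
    rintro ⟨g, k, hk⟩ _ ⟨h, rfl⟩
    exact ⟨h * k, by change (h * k) • x = op g • h • x; rw [mul_smul, hk, smul_comm]⟩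
  refine ⟨(X.resRight (X.rightSupport x)).sub (MulAction.orbit H x)
    (fun h _ ⟨k, hk⟩ => ⟨h * k, (mul_smul h k x).trans (congrArg (h • ·) hk)⟩) hr, ?_⟩
  refine comp_equiv_of_balanced (X := X)
    (fun (y : MulAction.orbit H x) (g : G) => op g • (y : X.carrier)) ?_ ?_ ?_ ?_
  · intro k (y : MulAction.orbit H x) (g : G)
    exact (smul_comm k (op g) (y : X.carrier)).symm
  · intro g (y : MulAction.orbit H x) (z : G)
    exact mul_smul (op g) (op z) (y : X.carrier)
  · intro y
    obtain ⟨h, g, rfl⟩ := hx y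
    exact ⟨⟨h • x, h, rfl⟩, (g : G), (smul_comm h (op g) x).symm⟩
  · intro ⟨_, h, rfl⟩ (g : G) ⟨_, h', rfl⟩ (g' : G)
    change op g • h • x = op g' • h' • x ↔ _
    constructor
    · intro e
      -- From `h x g = h' x g'` one gets `(h'⁻¹ h) x = x (g' g⁻¹)`, so `g' g⁻¹` lies in the right
      -- support.
      refine ⟨⟨g' * g⁻¹, h'⁻¹ * h, ?_⟩, Subtype.ext ?_, ?_⟩
      · rw [mul_smul, inv_smul_eq_iff, smul_comm h', op_mul, mul_smul, ← e,
          MulOpposite.op_inv, inv_smul_smul]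
      · change h • x = op (g' * g⁻¹) • h' • x
        rw [op_mul, mul_smul, ← e, MulOpposite.op_inv, inv_smul_smul]
      · exact inv_mul_cancel_right g' g
    · rintro ⟨q, h1, h2⟩
      have h1' : h • x = op (q : G) • h' • x := congrArg Subtype.val h1
      have h2' : (q : G) * g = g' := h2
      rw [h1', ← mul_smul, ← op_mul, h2']

/-- The hypothesis `hP` makes `X` a single left orbit. Since the actions commute, the right
stabilizer of `x` fixes every point, so the right action descends to the quotient and `Y` is `X`
with this action. -/
theorem exists_comp_deflation (hx : ∀ y, ∃ (h : H) (g : G), y = h • op g • x)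
    (hP : X.rightSupport x = ⊤) (hN : (X.rightStab x).Normal) :
    ∃ Y : Biset p H (G ⧸ X.rightStab x),
      Y.comp (deflation p (X.rightStab x) (X.not_dvd_card_rightStab x)) ≈ X := by
  have htriv : ∀ n ∈ X.rightStab x, ∀ y : X.carrier, op n • y = y := by
    intro n hn y
    obtain ⟨h, rfl⟩ := exists_smul_eq_of_rightSupport_eq_top hx hP y
    rw [← smul_comm h, show op n • x = x from hn]
  let Y := X.descRight (X.rightStab x) htriv
  refine ⟨Y, ?_⟩
  refine comp_equiv_of_balanced (X := X)
    (fun (y : Y.carrier) (q : G ⧸ X.rightStab x) => (op q • y : Y.carrier)) ?_ ?_ ?_ ?_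
  · exact fun k y (q : G ⧸ X.rightStab x) => (smul_comm k (op q) y).symm
  · intro g y q
    exact mul_smul (op (g : G ⧸ X.rightStab x)) (op (show G ⧸ X.rightStab x from q)) y
  · exact fun y => ⟨y, (1 : G ⧸ X.rightStab x),
      one_smul (G ⧸ X.rightStab x)ᵐᵒᵖ (show Y.carrier from y)⟩
  · intro y (q : G ⧸ X.rightStab x) y' (q' : G ⧸ X.rightStab x)
    change op q • y = op q' • y' ↔ ∃ r : G ⧸ X.rightStab x, y = op r • y' ∧ r * q = q'
    constructor
    · intro e
      refine ⟨q' * q⁻¹, ?_, inv_mul_cancel_right q' q⟩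
      rw [op_mul, mul_smul, ← e, MulOpposite.op_inv, inv_smul_smul]
    · rintro ⟨r, rfl, rfl⟩
      rw [← mul_smul, ← op_mul]

/-- A transitive biset factors through a group smaller than `G`, or comes from an isomorphism. -/
theorem factors_or_exists_ofIso_equiv (hc : Nat.card G = Nat.card H)
    (hx : ∀ y, ∃ (h : H) (g : G), y = h • op g • x) :
    (∃ (Q : Type u) (_ : Group Q) (_ : Finite Q) (Y : Biset p H Q) (Z : Biset p Q G),
      Nat.card Q < Nat.card G ∧ Y.comp Z ≈ X) ∨ ∃ f : G ≃* H, ofIso p f ≈ X := by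
  by_cases hP : X.rightSupport x = ⊤
  · by_cases hN : X.rightStab x = ⊥
    · exact Or.inr (exists_ofIso_equiv hc hx hP hN)
    · have := rightStab_normal hP
      obtain ⟨Y, hY⟩ := exists_comp_deflation hx hP this
      refine Or.inl ⟨G ⧸ X.rightStab x, inferInstance, inferInstance, Y, _, ?_, hY⟩
      rw [Subgroup.card_eq_card_quotient_mul_card_subgroup (X.rightStab x)]
      exact lt_mul_of_one_lt_right Nat.card_pos
        ((Subgroup.one_lt_card_iff_ne_bot _).mpr hN)
  · obtain ⟨Y, hY⟩ := exists_comp_restriction hx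
    refine Or.inl ⟨X.rightSupport x, inferInstance, inferInstance, Y, _, ?_, hY⟩
    exact lt_of_le_of_ne (Subgroup.card_le_card_group _)
      fun h => hP ((Subgroup.card_eq_iff_eq_top _).mp h)

end Transitive

end Biset

end PBifree

/-! ### The linear invariant that separates outer automorphisms. -/

namespace PBifree

namespace Biset

variable {p : ℕ} [Fact p.Prime] {K H G : Type u} [Group K] [Group H] [Group G]

theorem ofIso_comp_ofIso [Finite K] [Finite H] [Finite G] (f : H ≃* K) (g : G ≃* H) :
    (ofIso p f).comp (ofIso p g) ≈ ofIso p (g.trans f) := by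
  refine comp_equiv_of_balanced (X := ofIso p (g.trans f)) (fun (k : K) (h : H) => k * f h)
    ?_ ?_ ?_ ?_
  · exact fun k (y : K) (z : H) => mul_assoc k y (f z)
  · intro a (y : K) (z : H)
    change y * f (z * g a) = y * f z * f (g a)
    rw [map_mul, mul_assoc]
  · exact fun (k : K) => ⟨k, (1 : H), by rw [map_one]; exact mul_one k⟩
  · intro (k : K) (h : H) (k' : K) (h' : H)
    change k * f h = k' * f h' ↔ ∃ l : H, k = k' * f l ∧ l * h = h'
    constructor
    · intro e
      refine ⟨h' * h⁻¹, ?_, inv_mul_cancel_right h' h⟩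
      rw [map_mul, ← mul_assoc, ← e, map_inv, mul_inv_cancel_right]
    · rintro ⟨l, rfl, rfl⟩
      rw [map_mul, mul_assoc]

/-- Right multiplication by `g` absorbs the conjugation: `(x · g h g⁻¹) g = (x g) h`. -/
theorem ofIso_conj [Finite G] (g : G) : ofIso p (MulAut.conj g) ≈ ofIso p (MulEquiv.refl G) := by
  refine ⟨⟨(Equiv.mulRight g : G ≃ G), ?_, ?_⟩⟩
  · exact fun (h : G) (x : G) => mul_assoc h x g
  · intro (h : G) (x : G)
    change x * (g * h * g⁻¹) * g = x * g * h
    group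

end Biset

section Twist

variable {p : ℕ} {K H G : Type u} [Group K] [Group H] [Group G]

namespace Biset

/-- The left stabilizer of `x` is trivial, and the right action of `g` on `x` is the left action
of `a g`. -/
def IsTwist (X : Biset p G G) (x : X.carrier) (a : MulAut G) : Prop :=
  (∀ h : G, h • x = x → h = 1) ∧ ∀ g : G, op g • x = a g • x

/-- Moving along a left orbit changes the twist by an inner automorphism, since `k x g = (k a(g)
k⁻¹) k x`. Hence the class in `Out G` depends only on the left orbit. -/
theorem IsTwist.smul {X : Biset p G G} {x : X.carrier} {a : MulAut G} (h : X.IsTwist x a)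
    (k : G) : X.IsTwist (k • x) (MulAut.conj k * a) := by
  refine ⟨fun l hl => ?_, fun g => ?_⟩
  · have h1 := h.1 (k⁻¹ * l * k) (by rw [mul_smul, mul_smul, hl, inv_smul_smul])
    have h2 : l = k * (k⁻¹ * l * k) * k⁻¹ := by group
    rw [h2, h1]
    group
  · rw [← smul_comm k, h.2]
    simp [← mul_smul]

theorem IsTwist.unique {X : Biset p G G} {x : X.carrier} {a b : MulAut G} (ha : X.IsTwist x a)
    (hb : X.IsTwist x b) : a = b := by
  ext g
  have h := ha.1 ((b g)⁻¹ * a g) (by rw [mul_smul, ← ha.2, hb.2, inv_smul_smul])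
  exact (inv_mul_eq_one.mp h).symm

theorem isTwist_map_iff {X Y : Biset p G G} {i : X.carrier → Y.carrier}
    (hi : Function.Injective i) (hl : ∀ (h : G) x, i (h • x) = h • i x)
    (hr : ∀ (g : G) x, i (op g • x) = op g • i x) {x : X.carrier} {a : MulAut G} :
    Y.IsTwist (i x) a ↔ X.IsTwist x a := by
  simp only [IsTwist, ← hl, ← hr, hi.eq_iff]

variable (R : Type w) [CommRing R]

open Classical in
/-- The class in `R Out(G)` of the automorphism by which the right action on `x` differs from the
left action, if there is one; otherwise `0`. -/
noncomputable def twistClass (X : Biset p G G) (x : X.carrier) : MonoidAlgebra R (Out G) :=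
  if h : ∃ a, X.IsTwist x a then MonoidAlgebra.single (QuotientGroup.mk h.choose) 1 else 0

theorem IsTwist.twistClass_eq {X : Biset p G G} {x : X.carrier} {a : MulAut G}
    (h : X.IsTwist x a) : X.twistClass R x = MonoidAlgebra.single (QuotientGroup.mk a) 1 := by
  have h' : ∃ a, X.IsTwist x a := ⟨a, h⟩
  rw [twistClass, dif_pos h', h'.choose_spec.unique h]

theorem twistClass_eq_zero {X : Biset p G G} {x : X.carrier} (h : ∀ a, ¬ X.IsTwist x a) :
    X.twistClass R x = 0 :=
  dif_neg (not_exists.mpr h)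

theorem twistClass_map {X Y : Biset p G G} {i : X.carrier → Y.carrier}
    (hi : Function.Injective i) (hl : ∀ (h : G) x, i (h • x) = h • i x)
    (hr : ∀ (g : G) x, i (op g • x) = op g • i x) (x : X.carrier) :
    Y.twistClass R (i x) = X.twistClass R x := by
  have h : Y.IsTwist (i x) = X.IsTwist x :=
    funext fun a => propext (isTwist_map_iff hi hl hr)
  unfold twistClass
  rw [h]

theorem twistClass_smul (X : Biset p G G) (k : G) (x : X.carrier) :
    X.twistClass R (k • x) = X.twistClass R x := by
  by_cases h : ∃ a, X.IsTwist x a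
  · obtain ⟨a, ha⟩ := h
    rw [ha.twistClass_eq R, (ha.smul k).twistClass_eq R]
    congr 1
    have hk : (QuotientGroup.mk (MulAut.conj k) : Out G) = 1 :=
      (QuotientGroup.eq_one_iff _).mpr ⟨k, rfl⟩
    rw [QuotientGroup.mk_mul, hk, one_mul]
  · rw [twistClass_eq_zero R (not_exists.mp h), twistClass_eq_zero]
    intro a ha
    have := ha.smul k⁻¹
    rw [inv_smul_smul] at this
    exact h ⟨_, this⟩

/-- The sum of the classes of automorphisms attached to the left orbits of a biset. -/
noncomputable def twistSum (X : Biset p G G) : MonoidAlgebra R (Out G) :=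
  ∑ᶠ ω : MulAction.orbitRel.Quotient G X.carrier, X.twistClass R (Quotient.out ω)

theorem twistClass_out (X : Biset p G G) (x : X.carrier) :
    X.twistClass R (Quotient.out (Quotient.mk (MulAction.orbitRel G X.carrier) x)) =
      X.twistClass R x := by
  obtain ⟨k, hk⟩ := Quotient.mk_out (s := MulAction.orbitRel G X.carrier) x
  rw [← hk]
  exact twistClass_smul R X k x

theorem twistSum_congr {X Y : Biset p G G} (h : X ≈ Y) : X.twistSum R = Y.twistSum R := by
  obtain ⟨f⟩ := h
  have hrel : ∀ x y : X.carrier, MulAction.orbitRel G X.carrier x y ↔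
      MulAction.orbitRel G Y.carrier (f.toEquiv x) (f.toEquiv y) := fun x y =>
    exists_congr fun k => by
      rw [← f.toEquiv.injective.eq_iff]
      exact Eq.congr_left (f.map_left k y)
  refine finsum_eq_of_bijective (Quotient.congr f.toEquiv hrel)
    (Quotient.congr f.toEquiv hrel).bijective ?_
  rintro ⟨x⟩
  refine (twistClass_out R X x).trans (Eq.trans ?_ (twistClass_out R Y (f.toEquiv x)).symm)
  exact (twistClass_map R f.toEquiv.injective f.map_left f.map_right x).symm

theorem twistSum_empty : (empty p G G).twistSum R = 0 := by
  have : IsEmpty (MulAction.orbitRel.Quotient G (empty p G G).carrier) :=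
    ⟨by rintro ⟨x⟩; exact PEmpty.elim x⟩
  exact finsum_of_isEmpty _

theorem exists_smul_of_mk_eq (X : Biset p H G) {x y : X.carrier}
    (h : Quotient.mk (MulAction.orbitRel H X.carrier) x = Quotient.mk _ y) :
    ∃ k : H, k • y = x :=
  Quotient.exact h

theorem twistSum_sum (X Y : Biset p G G) :
    (X.sum Y).twistSum R = X.twistSum R + Y.twistSum R := by
  let i : MulAction.orbitRel.Quotient G X.carrier ⊕ MulAction.orbitRel.Quotient G Y.carrier →
      MulAction.orbitRel.Quotient G (X.sum Y).carrier :=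
    Sum.elim
      (Quotient.map' (s₂ := MulAction.orbitRel G (X.sum Y).carrier) Sum.inl (by
        rintro a b ⟨k, rfl⟩; exact ⟨k, rfl⟩))
      (Quotient.map' (s₂ := MulAction.orbitRel G (X.sum Y).carrier) Sum.inr (by
        rintro a b ⟨k, rfl⟩; exact ⟨k, rfl⟩))
  have hi : Function.Bijective i := by
    constructor
    · rintro (x | x) (y | y) hxy <;> induction x using Quotient.inductionOn <;>
        induction y using Quotient.inductionOn <;> rename_i x y
      · obtain ⟨k, hk⟩ := (X.sum Y).exists_smul_of_mk_eq (x := Sum.inl x) (y := Sum.inl y) hxy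
        exact congrArg Sum.inl (Quotient.sound (s := MulAction.orbitRel G X.carrier)
          ⟨k, Sum.inl_injective hk⟩)
      · obtain ⟨k, hk⟩ := (X.sum Y).exists_smul_of_mk_eq (x := Sum.inl x) (y := Sum.inr y) hxy
        exact (Sum.inr_ne_inl hk).elim
      · obtain ⟨k, hk⟩ := (X.sum Y).exists_smul_of_mk_eq (x := Sum.inr x) (y := Sum.inl y) hxy
        exact (Sum.inl_ne_inr hk).elim
      · obtain ⟨k, hk⟩ := (X.sum Y).exists_smul_of_mk_eq (x := Sum.inr x) (y := Sum.inr y) hxy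
        exact congrArg Sum.inr (Quotient.sound (s := MulAction.orbitRel G Y.carrier)
          ⟨k, Sum.inr_injective hk⟩)
    · rintro ⟨x | x⟩
      · exact ⟨Sum.inl (Quotient.mk _ x), rfl⟩
      · exact ⟨Sum.inr (Quotient.mk _ x), rfl⟩
  have : Fintype (MulAction.orbitRel.Quotient G X.carrier) := Fintype.ofFinite _
  have : Fintype (MulAction.orbitRel.Quotient G Y.carrier) := Fintype.ofFinite _
  have h : X.twistSum R + Y.twistSum R =
      ∑ᶠ ω : MulAction.orbitRel.Quotient G X.carrier ⊕ MulAction.orbitRel.Quotient G Y.carrier,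
        Sum.elim (fun ω => X.twistClass R (Quotient.out ω))
        (fun ω => Y.twistClass R (Quotient.out ω)) ω := by
    rw [finsum_eq_sum_of_fintype, Fintype.sum_sum_type]
    simp only [twistSum, finsum_eq_sum_of_fintype, Sum.elim_inl, Sum.elim_inr]
  rw [h]
  refine (finsum_eq_of_bijective i hi ?_).symm
  rintro (x | x) <;> induction x using Quotient.inductionOn <;> rename_i x
  · refine (twistClass_out R X x).trans (Eq.trans ?_ (twistClass_out R (X.sum Y) (Sum.inl x)).symm)
    exact (twistClass_map R (Y := X.sum Y) Sum.inl_injective (fun _ _ => rfl)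
      (fun _ _ => rfl) x).symm
  · refine (twistClass_out R Y x).trans (Eq.trans ?_ (twistClass_out R (X.sum Y) (Sum.inr x)).symm)
    exact (twistClass_map R (Y := X.sum Y) Sum.inr_injective (fun _ _ => rfl)
      (fun _ _ => rfl) x).symm

/-- The biset is a single free left orbit, and its twist at the point `1` is `a` itself. -/
theorem twistSum_ofIso [Fact p.Prime] [Finite G] (a : MulAut G) :
    (ofIso p a).twistSum R = MonoidAlgebra.single (QuotientGroup.mk a) 1 := by
  have h1 : (ofIso p a).IsTwist (1 : G) a := by
    refine ⟨fun h hh => ?_, fun g => ?_⟩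
    · exact (mul_one h).symm.trans hh
    · change 1 * a g = a g * 1
      rw [one_mul, mul_one]
  have hall : ∀ x : (ofIso p a).carrier, (ofIso p a).twistClass R x =
      MonoidAlgebra.single (QuotientGroup.mk a) 1 := by
    intro (x : G)
    have h2 : (ofIso p a).twistClass R x = (ofIso p a).twistClass R (1 : G) := by
      refine Eq.trans ?_ (twistClass_smul R (ofIso p a) x (1 : G))
      exact congrArg ((ofIso p a).twistClass R) (mul_one x).symm
    rw [h2, h1.twistClass_eq R]
  have : Unique (MulAction.orbitRel.Quotient G (ofIso p a).carrier) :=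
    { default := Quotient.mk _ (1 : G)
      uniq := by
        rintro ⟨x⟩
        exact Quotient.sound ⟨(show G from x), mul_one (show G from x)⟩ }
  rw [twistSum, finsum_unique, hall]

/-- If the class of `(y, z)` had twist `a`, then `a(g) (y, z) = (y, z g)` would give `h = σ g` in
`H` with `a(g) y = y h`. If `σ g = σ g'`, then `a(g')⁻¹ a(g)` fixes `y`, hence the class of `(y,
z)`, hence is `1`. So `σ` would embed `G` in the smaller set `H`. -/
theorem twistSum_comp_of_card_lt [Fact p.Prime] [Finite H] [Finite G]
    (hc : Nat.card H < Nat.card G) (Y : Biset p G H) (Z : Biset p H G) :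
    (Y.comp Z).twistSum R = 0 := by
  refine (finsum_congr fun ω => ?_).trans finsum_zero
  refine twistClass_eq_zero R fun a ha => ?_
  obtain ⟨⟨y, z⟩, hyz⟩ := Quotient.exists_rep (Quotient.out ω)
  have hyz : Quotient.mk (compSetoid Y Z) (y, z) = Quotient.out ω := hyz
  rw [← hyz] at ha
  have hex : ∀ g : G, ∃ h : H, op h • y = a g • y := by
    intro g
    obtain ⟨h, h1, -⟩ := Quotient.exact (ha.2 g).symm
    have h1 : a g • y = op h • y := h1
    exact ⟨h, h1.symm⟩
  choose σ hσ using hex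
  refine hc.not_ge (Nat.card_le_card_of_injective σ fun g g' hg => a.injective ?_)
  have h1 : a g • y = a g' • y := by rw [← hσ, ← hσ, hg]
  have h2 := ha.1 ((a g')⁻¹ * a g)
    (congrArg (fun y => Quotient.mk (compSetoid Y Z) (y, z)) (show ((a g')⁻¹ * a g) • y = y by
      rw [mul_smul, h1, inv_smul_smul]))
  exact (inv_mul_eq_one.mp h2).symm

end Biset

variable (R : Type w) [CommRing R]

variable (p G) in
/-- The linear extension of `Biset.twistSum` to `R B^Δ(G, G)`. -/
noncomputable def RB.twistSum : RB p G G R →ₗ[R] MonoidAlgebra R (Out G) :=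
  LinearMap.liftBaseChange R (AddMonoidHom.toIntLinearMap
    (Algebra.GrothendieckAddGroup.lift
      { toFun := Quotient.lift (fun X : Biset p G G => X.twistSum R)
          fun _ _ h => Biset.twistSum_congr R h
        map_zero' := Biset.twistSum_empty R
        map_add' := by
          rintro ⟨X⟩ ⟨Y⟩
          exact Biset.twistSum_sum R X Y }))

theorem RB.twistSum_mk (X : Biset p G G) : RB.twistSum p G R (RB.mk R X) = X.twistSum R := by
  simp only [RB.twistSum, RB.mk, LinearMap.liftBaseChange_tmul, one_smul,
    AddMonoidHom.coe_toIntLinearMap, BurnsideGroup.lift_mk]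
  rfl

theorem RB.twistSum_comp_of_card_lt [Fact p.Prime] [Finite H] [Finite G]
    (hc : Nat.card H < Nat.card G) (y : RB p G H R) (z : RB p H G R) :
    RB.twistSum p G R (RB.comp R y z) = 0 := by
  have h : (RB.comp R : RB p G H R →ₗ[R] RB p H G R →ₗ[R] RB p G G R).compr₂
      (RB.twistSum p G R) = 0 :=
    RB.hom_ext fun Y => RB.hom_ext fun Z => by
      rw [LinearMap.compr₂_apply, RB.comp_mk, RB.twistSum_mk,
        Biset.twistSum_comp_of_card_lt R hc]
      rfl
  exact LinearMap.congr_fun₂ h y z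

end Twist

end PBifree

/-! ### Transitive bisets as generators. -/

namespace PBifree

section Generators

variable {R : Type w} [CommRing R] {p : ℕ} {H G : Type u} [Group H] [Group G]

theorem RB.mk_sum (X Y : Biset p H G) : RB.mk R (X.sum Y) = RB.mk R X + RB.mk R Y := by
  have h : BurnsideGroup.mk (X.sum Y) = BurnsideGroup.mk X + BurnsideGroup.mk Y :=
    map_add Algebra.GrothendieckAddGroup.of (BisetClass.mk X) (BisetClass.mk Y)
  rw [RB.mk, h, TensorProduct.tmul_add]
  rfl

theorem RB.mk_of_isEmpty (X : Biset p H G) [IsEmpty X.carrier] : RB.mk R X = 0 := by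
  have : IsEmpty (Biset.empty p H G).carrier := inferInstanceAs (IsEmpty PEmpty)
  have h : X ≈ Biset.empty p H G :=
    ⟨⟨Equiv.equivOfIsEmpty _ _, fun _ x => isEmptyElim x, fun _ x => isEmptyElim x⟩⟩
  rw [RB.mk_eq R h, RB.mk,
    show BurnsideGroup.mk (Biset.empty p H G) = 0 from map_zero Algebra.GrothendieckAddGroup.of,
    TensorProduct.tmul_zero]

/-- A submodule of `R B^Δ(H, G)` containing the classes of the transitive bisets is everything. -/
theorem RB.eq_top_of_transitive_mem (M : Submodule R (RB p H G R))
    (hM : ∀ (X : Biset p H G) (x : X.carrier), (∀ y, ∃ (h : H) (g : G), y = h • op g • x) →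
      RB.mk R X ∈ M) : M = ⊤ := by
  -- Strong induction on the number of elements: split off the orbit of one point under both groups.
  have key : ∀ (n : ℕ) (X : Biset p H G), Nat.card X.carrier = n → RB.mk R X ∈ M := by
    intro n
    induction n using Nat.strong_induction_on with
    | _ n ih =>
      intro X hn
      rcases isEmpty_or_nonempty X.carrier with hX | ⟨⟨x⟩⟩
      · rw [RB.mk_of_isEmpty]
        exact M.zero_mem
      · let S : Set X.carrier := {y | ∃ (h : H) (g : G), y = h • op g • x}
        have hl : ∀ h : H, ∀ y ∈ S, h • y ∈ S := by
          rintro h _ ⟨k, g, rfl⟩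
          exact ⟨h * k, g, (mul_smul h k _).symm⟩
        have hr : ∀ g : G, ∀ y ∈ S, op g • y ∈ S := by
          rintro g _ ⟨k, g', rfl⟩
          exact ⟨k, g' * g, by rw [← smul_comm k, op_mul, mul_smul]⟩
        have hl' : ∀ h : H, ∀ y ∈ Sᶜ, h • y ∈ Sᶜ := fun h y hy hy' => hy (by
          simpa using hl h⁻¹ _ hy')
        have hr' : ∀ g : G, ∀ y ∈ Sᶜ, op g • y ∈ Sᶜ := fun g y hy hy' => hy (by
          simpa using hr g⁻¹ _ hy')
        have hxS : x ∈ S := ⟨1, 1, by simp⟩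
        rw [← RB.mk_eq R (X.sub_sum_sub_compl S hl hr hl' hr'), RB.mk_sum]
        refine M.add_mem (hM _ ⟨x, hxS⟩ ?_) (ih _ ?_ _ rfl)
        · rintro ⟨_, h, g, rfl⟩
          exact ⟨h, g, rfl⟩
        · rw [← hn]
          exact Finite.card_subtype_lt (p := fun y => y ∈ Sᶜ) (x := x) (fun h => h hxS)
  have h0 : M.mkQ = 0 := RB.hom_ext fun X => by
    rw [Submodule.mkQ_apply, LinearMap.zero_apply, Submodule.Quotient.mk_eq_zero]
    exact key _ X rfl
  rw [← M.ker_mkQ, h0, LinearMap.ker_zero]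

end Generators

/-! ### The essential algebra and its identification with `R Out(G)`. -/

section Essential

variable {R : Type w} [CommRing R] {p : ℕ} [Fact p.Prime]

namespace BisetCat

theorem homOfBiset_comp {G H K : BisetCat.{u, w} R p} (X : Biset p H.carrier G.carrier)
    (Y : Biset p K.carrier H.carrier) :
    homOfBiset X ≫ homOfBiset Y = (homOfBiset (Y.comp X) : G ⟶ K) :=
  RB.comp_mk R Y X

theorem homOfBiset_eq {G H : BisetCat.{u, w} R p} {X Y : Biset p H.carrier G.carrier}
    (h : X ≈ Y) : (homOfBiset X : G ⟶ H) = homOfBiset Y :=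
  RB.mk_eq R h

variable (R) in
/-- The morphism of `R C^Δ` given by a group isomorphism. -/
noncomputable abbrev homOfIso {G H : BisetCat.{u, w} R p} (f : G.carrier ≃* H.carrier) : G ⟶ H :=
  homOfBiset (Biset.ofIso p f)

theorem homOfIso_comp {G H K : BisetCat.{u, w} R p} (f : G.carrier ≃* H.carrier)
    (g : H.carrier ≃* K.carrier) :
    homOfIso R f ≫ homOfIso R g = homOfIso R (f.trans g) :=
  (homOfBiset_comp _ _).trans (homOfBiset_eq (Biset.ofIso_comp_ofIso g f))

theorem homOfIso_refl (G : BisetCat.{u, w} R p) : homOfIso R (MulEquiv.refl G.carrier) = 𝟙 G :=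
  rfl

/-- Isomorphic groups are isomorphic objects of `R C^Δ`. -/
noncomputable def isoOfMulEquiv {G H : BisetCat.{u, w} R p} (f : G.carrier ≃* H.carrier) :
    G ≅ H where
  hom := homOfIso R f
  inv := homOfIso R f.symm
  hom_inv_id := by rw [homOfIso_comp, MulEquiv.self_trans_symm, homOfIso_refl]
  inv_hom_id := by rw [homOfIso_comp, MulEquiv.symm_trans_self, homOfIso_refl]

/-- The submodule of the morphisms generated by those which factor through a group of order
smaller than that of the source. -/
noncomputable def factoring (G H : BisetCat.{u, w} R p) : Submodule R (G ⟶ H) :=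
  Submodule.span R {f | ∃ (K : BisetCat.{u, w} R p) (x : G ⟶ K) (y : K ⟶ H),
    Nat.card K.carrier < Nat.card G.carrier ∧ f = x ≫ y}

theorem mem_essentialIdeal {G : BisetCat.{u, w} R p} {f : End G} :
    f ∈ essentialIdeal G ↔ f.asHom ∈ factoring G G := Iff.rfl

theorem comp_mem_factoring {G H K : BisetCat.{u, w} R p} {x : G ⟶ H} (hx : x ∈ factoring G H)
    (y : H ⟶ K) : x ≫ y ∈ factoring G K := by
  have h : factoring G H ≤ (factoring G K).comap (Linear.rightComp R G y) := by
    refine Submodule.span_le.mpr ?_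
    rintro _ ⟨L, a, b, hL, rfl⟩
    exact Submodule.subset_span ⟨L, a, b ≫ y, hL, Category.assoc a b y⟩
  exact h hx

/-- Between groups of the same order, the group isomorphisms generate all morphisms up to those
which factor through smaller groups. -/
theorem span_homOfIso_sup_factoring {G H : BisetCat.{u, w} R p}
    (hc : Nat.card G.carrier = Nat.card H.carrier) :
    Submodule.span R (Set.range fun f : G.carrier ≃* H.carrier => (homOfIso R f : G ⟶ H)) ⊔
      factoring G H = ⊤ := by
  refine RB.eq_top_of_transitive_mem _ fun X x hx => ?_
  rcases Biset.factors_or_exists_ofIso_equiv hc hx with ⟨Q, _, _, Y, Z, hQ, h⟩ | ⟨f, hf⟩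
  · refine Submodule.mem_sup_right (Submodule.subset_span ?_)
    refine ⟨⟨Q⟩, homOfBiset Z, homOfBiset Y, hQ, ?_⟩
    rw [homOfBiset_comp]
    exact (homOfBiset_eq h).symm
  · refine Submodule.mem_sup_left (Submodule.subset_span ⟨f, ?_⟩)
    exact homOfBiset_eq hf

/-- This separates nonisomorphic groups of the same order: no isomorphisms are left among the
generators. -/
theorem factoring_eq_top_of_isEmpty {G H : BisetCat.{u, w} R p}
    (hc : Nat.card G.carrier = Nat.card H.carrier) [IsEmpty (G.carrier ≃* H.carrier)] :
    factoring G H = ⊤ := by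
  have h := span_homOfIso_sup_factoring (R := R) hc
  rwa [Set.range_eq_empty, Submodule.span_empty, bot_sup_eq] at h

end BisetCat

open BisetCat

variable (G : BisetCat.{u, w} R p)

theorem mk_homOfIso_mul (a b : MulAut G.carrier) :
    Ideal.Quotient.mk (essentialIdeal G) (homOfIso R (a * b)) =
      Ideal.Quotient.mk (essentialIdeal G) (homOfIso R a) *
        Ideal.Quotient.mk (essentialIdeal G) (homOfIso R b) := by
  rw [← map_mul]
  -- The product `x * y` in `End G` is `y ≫ x`, and `a * b` is `b.trans a`; the two reversals agree,
  -- so no opposite algebra appears.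
  exact congrArg _ (homOfIso_comp (R := R) b a).symm

/-- The homomorphism sending the class of an automorphism to the class of its biset. -/
noncomputable def outToEssential : Out G.carrier →* EssentialAlgebra G :=
  QuotientGroup.lift _
    { toFun := fun a => Ideal.Quotient.mk (essentialIdeal G) (homOfIso R a)
      map_one' := map_one (Ideal.Quotient.mk (essentialIdeal G))
      map_mul' := mk_homOfIso_mul G } (by
    rintro _ ⟨g, rfl⟩
    refine (congrArg (Ideal.Quotient.mk (essentialIdeal G))
      (homOfBiset_eq (Biset.ofIso_conj g))).trans ?_
    exact map_one (Ideal.Quotient.mk (essentialIdeal G)))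

/-- The algebra homomorphism `R Out(G) → E^Δ(G)`. -/
noncomputable def outAlgebraToEssential :
    MonoidAlgebra R (Out G.carrier) →ₐ[R] EssentialAlgebra G :=
  MonoidAlgebra.lift R _ _ (outToEssential G)

theorem outAlgebraToEssential_single (a : MulAut G.carrier) :
    outAlgebraToEssential G (MonoidAlgebra.single (QuotientGroup.mk a) 1) =
      Ideal.Quotient.mk (essentialIdeal G) (homOfIso R a) := by
  rw [outAlgebraToEssential, MonoidAlgebra.lift_single, one_smul]
  rfl

/-- The linear map `E^Δ(G) → R Out(G)` induced by `RB.twistSum`. -/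
noncomputable def essentialToOut : EssentialAlgebra G →ₗ[R] MonoidAlgebra R (Out G.carrier) :=
  -- The essential ideal has the same underlying set as `factoring G G`, so a linear map vanishing
  -- on composites through smaller groups descends.
  (factoring G G).liftQ (RB.twistSum p G.carrier R) (by
    refine Submodule.span_le.mpr ?_
    rintro _ ⟨H, x, y, h, rfl⟩
    exact RB.twistSum_comp_of_card_lt R h y x)

theorem essentialToOut_outAlgebraToEssential (z : MonoidAlgebra R (Out G.carrier)) :
    essentialToOut G (outAlgebraToEssential G z) = z := by
  have h : essentialToOut G ∘ₗ (outAlgebraToEssential G).toLinearMap = LinearMap.id := by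
    refine MonoidAlgebra.lhom_ext' fun α => LinearMap.ext_ring ?_
    obtain ⟨a, rfl⟩ := QuotientGroup.mk_surjective α
    change essentialToOut G (outAlgebraToEssential G (MonoidAlgebra.single (QuotientGroup.mk a) 1))
      = MonoidAlgebra.single (QuotientGroup.mk a) 1
    rw [outAlgebraToEssential_single, ← Biset.twistSum_ofIso (p := p) R a]
    exact RB.twistSum_mk R (Biset.ofIso p a)
  exact DFunLike.congr_fun h z

/-- Modulo the essential ideal every endomorphism is a combination of automorphism bisets, by
`span_homOfIso_sup_factoring` with equal source and target. -/
theorem outAlgebraToEssential_surjective : Function.Surjective (outAlgebraToEssential G) := by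
  intro z
  obtain ⟨f, rfl⟩ := Ideal.Quotient.mk_surjective z
  have hf : f.asHom ∈ (⊤ : Submodule R (G ⟶ G)) := Submodule.mem_top
  rw [← span_homOfIso_sup_factoring rfl] at hf
  obtain ⟨a, ha, b, hb, hab⟩ := Submodule.mem_sup.mp hf
  have h0 : Ideal.Quotient.mk (essentialIdeal G) f = Ideal.Quotient.mkₐ R (essentialIdeal G) a := by
    refine Ideal.Quotient.eq.mpr ?_
    rw [mem_essentialIdeal]
    have h1 : f.asHom - a = b := by rw [← hab, add_sub_cancel_left]
    exact h1 ▸ hb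
  rw [h0]
  have hle : Submodule.span R (Set.range fun f : G.carrier ≃* G.carrier => (homOfIso R f : G ⟶ G)) ≤
      (LinearMap.range (outAlgebraToEssential G).toLinearMap).comap
        (Ideal.Quotient.mkₐ R (essentialIdeal G)).toLinearMap := by
    refine Submodule.span_le.mpr ?_
    rintro _ ⟨c, rfl⟩
    exact ⟨_, outAlgebraToEssential_single G c⟩
  exact hle ha

/-- The isomorphism `E^Δ(G) ≃ R Out(G)`. -/
noncomputable def essentialEquiv :
    EssentialAlgebra G ≃ₐ[R] MonoidAlgebra R (Out G.carrier) :=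
  (AlgEquiv.ofBijective (outAlgebraToEssential G)
    ⟨Function.LeftInverse.injective (essentialToOut_outAlgebraToEssential G),
      outAlgebraToEssential_surjective G⟩).symm

theorem essentialEquiv_homOfIso (a : MulAut G.carrier) :
    essentialEquiv G (Ideal.Quotient.mk (essentialIdeal G) (homOfIso R a)) =
      MonoidAlgebra.single (QuotientGroup.mk a) 1 := by
  rw [essentialEquiv, AlgEquiv.symm_apply_eq]
  exact (outAlgebraToEssential_single G a).symm

variable {G}

/-- The conjugation `End(G) → End(H)` by an isomorphism of groups corresponds to the isomorphism
`R Out(G) → R Out(H)`. -/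
theorem essentialEquiv_conj {H : BisetCat.{u, w} R p} (f : G.carrier ≃* H.carrier) (x : G ⟶ G) :
    essentialEquiv H (Ideal.Quotient.mk (essentialIdeal H)
      (homOfIso R f.symm ≫ x ≫ homOfIso R f : H ⟶ H)) =
    MonoidAlgebra.domCongr R R (outCongr f)
      (essentialEquiv G (Ideal.Quotient.mk (essentialIdeal G) x)) := by
  let φ : (G ⟶ G) →ₗ[R] MonoidAlgebra R (Out H.carrier) :=
    (essentialEquiv H).toLinearMap ∘ₗ (Ideal.Quotient.mkₐ R (essentialIdeal H)).toLinearMap ∘ₗ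
      Linear.leftComp R H (homOfIso R f.symm) ∘ₗ Linear.rightComp R G (homOfIso R f)
  let ψ : (G ⟶ G) →ₗ[R] MonoidAlgebra R (Out H.carrier) :=
    (MonoidAlgebra.domCongr R R (outCongr f)).toLinearMap ∘ₗ (essentialEquiv G).toLinearMap ∘ₗ
      (Ideal.Quotient.mkₐ R (essentialIdeal G)).toLinearMap
  -- Both sides are linear in `x`, so generators suffice: on isomorphisms the claim is conjugation
  -- of automorphisms, and on maps through smaller groups both sides vanish.
  have hle : ⊤ ≤ LinearMap.eqLocus φ ψ := by
    rw [← span_homOfIso_sup_factoring rfl]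
    refine sup_le (Submodule.span_le.mpr ?_) (Submodule.span_le.mpr ?_)
    · rintro _ ⟨a, rfl⟩
      change essentialEquiv H (Ideal.Quotient.mk (essentialIdeal H)
          (homOfIso R f.symm ≫ homOfIso R a ≫ homOfIso R f : H ⟶ H)) =
        MonoidAlgebra.domCongr R R (outCongr f)
          (essentialEquiv G (Ideal.Quotient.mk (essentialIdeal G) (homOfIso R a)))
      rw [homOfIso_comp, homOfIso_comp]
      refine (essentialEquiv_homOfIso H (MulAut.congr f a)).trans ?_
      rw [essentialEquiv_homOfIso, MonoidAlgebra.domCongr_single]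
      rfl
    · rintro _ ⟨K, x, y, hK, rfl⟩
      change essentialEquiv H (Ideal.Quotient.mk (essentialIdeal H)
          (homOfIso R f.symm ≫ (x ≫ y) ≫ homOfIso R f : H ⟶ H)) =
        MonoidAlgebra.domCongr R R (outCongr f)
          (essentialEquiv G (Ideal.Quotient.mk (essentialIdeal G) (x ≫ y : G ⟶ G)))
      have h1 : Ideal.Quotient.mk (essentialIdeal H)
          (homOfIso R f.symm ≫ (x ≫ y) ≫ homOfIso R f : H ⟶ H) = 0 := by
        refine Ideal.Quotient.eq_zero_iff_mem.mpr (Submodule.subset_span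
          ⟨K, homOfIso R f.symm ≫ x, y ≫ homOfIso R f, ?_, ?_⟩)
        · rwa [← Nat.card_congr f.toEquiv]
        · simp only [Category.assoc]
      have h2 : Ideal.Quotient.mk (essentialIdeal G) (x ≫ y : G ⟶ G) = 0 :=
        Ideal.Quotient.eq_zero_iff_mem.mpr (Submodule.subset_span ⟨K, x, y, hK, rfl⟩)
      rw [h1, h2, map_zero, map_zero, map_zero]
  exact hle (Submodule.mem_top (x := x))

end Essential

end PBifree

/-! ### Subfunctors and simple biset functors. -/

namespace PBifree

section SimpleFunctors

variable {R : Type w} [CommRing R] {p : ℕ} [Fact p.Prime]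

namespace BisetFunctor

variable {F F' : BisetFunctor.{u, w} R p}

/-- A family of submodules of the values of a functor which is stable under all morphisms. -/
def IsStable (F : BisetFunctor.{u, w} R p) (N : ∀ K, Submodule R (F.obj.obj K)) : Prop :=
  ∀ ⦃K L : BisetCat.{u, w} R p⦄ (f : K ⟶ L) (z : F.obj.obj K), z ∈ N K → F.obj.map f z ∈ N L

theorem map_add (F : BisetFunctor.{u, w} R p) {K L : BisetCat.{u, w} R p} (f g : K ⟶ L) :
    F.obj.map (f + g) = F.obj.map f + F.obj.map g :=
  F.property.1.map_add

theorem map_smul (F : BisetFunctor.{u, w} R p) {K L : BisetCat.{u, w} R p} (r : R) (f : K ⟶ L) :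
    F.obj.map (r • f) = r • F.obj.map f :=
  F.property.2.map_smul f r

theorem map_comp_apply (F : BisetFunctor.{u, w} R p) {K L M : BisetCat.{u, w} R p} (f : K ⟶ L)
    (g : L ⟶ M) (z : F.obj.obj K) : F.obj.map (f ≫ g) z = F.obj.map g (F.obj.map f z) :=
  congrArg (fun h => h.hom z) (F.obj.map_comp f g)

/-- The subfunctor given by a stable family of submodules. -/
def subfunctor {N : ∀ K, Submodule R (F.obj.obj K)} (hN : IsStable F N) :
    BisetFunctor.{u, w} R p where
  obj :=
    { obj := fun K => ModuleCat.of R (N K)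
      map := fun {K L} f => ModuleCat.ofHom ((F.obj.map f).hom.restrict (hN f))
      map_id := fun K => by
        refine ModuleCat.hom_ext (LinearMap.ext fun z => Subtype.ext ?_)
        exact congrArg (fun h => h.hom z.1) (F.obj.map_id K)
      map_comp := fun f g => by
        refine ModuleCat.hom_ext (LinearMap.ext fun z => Subtype.ext ?_)
        exact congrArg (fun h => h.hom z.1) (F.obj.map_comp f g) }
  property :=
    ⟨⟨fun {K L f g} => by
      refine ModuleCat.hom_ext (LinearMap.ext fun z => Subtype.ext ?_)
      exact congrArg (fun h => h.hom z.1) (F.map_add f g)⟩,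
    ⟨fun {K L} f r => by
      refine ModuleCat.hom_ext (LinearMap.ext fun z => Subtype.ext ?_)
      exact congrArg (fun h => h.hom z.1) (F.map_smul r f)⟩⟩

/-- The inclusion of a subfunctor. -/
def subfunctorι {N : ∀ K, Submodule R (F.obj.obj K)} (hN : IsStable F N) :
    subfunctor hN ⟶ F where
  hom :=
    { app := fun K => ModuleCat.ofHom (N K).subtype
      naturality := fun _ _ _ => rfl }

theorem hom_eq_zero_iff {f : F ⟶ F'} : f = 0 ↔ ∀ K z, f.hom.app K z = 0 := by
  constructor
  · rintro rfl K z
    rfl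
  · intro h
    ext K z
    exact h K z

theorem mono_of_injective (f : F ⟶ F') (hf : ∀ K, Function.Injective (f.hom.app K)) : Mono f where
  right_cancellation g h e := by
    ext K z
    exact hf K (congrArg (fun t => t.hom.app K z) e)

theorem naturality_apply (f : F ⟶ F') {K L : BisetCat.{u, w} R p} (x : K ⟶ L)
    (z : F.obj.obj K) : f.hom.app L (F.obj.map x z) = F'.obj.map x (f.hom.app K z) :=
  congrArg (fun h => h.hom z) (f.hom.naturality x)

/-- The pointwise kernel is a subfunctor whose inclusion is killed by `f`; cancelling `f` shows that
this inclusion is zero. -/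
theorem injective_of_mono (f : F ⟶ F') [Mono f] (K : BisetCat.{u, w} R p) :
    Function.Injective (f.hom.app K) := by
  have hN : IsStable F fun K => LinearMap.ker (f.hom.app K).hom := by
    intro K L x z (hz : f.hom.app K z = 0)
    change f.hom.app L (F.obj.map x z) = 0
    rw [naturality_apply, hz, _root_.map_zero]
  have h0 : subfunctorι hN = 0 := by
    rw [← cancel_mono f, Limits.zero_comp, hom_eq_zero_iff]
    rintro L ⟨z, hz⟩
    exact hz
  refine (injective_iff_map_eq_zero (f.hom.app K).hom).mpr fun z hz => ?_
  exact hom_eq_zero_iff.mp h0 K ⟨z, hz⟩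

theorem isIso_of_bijective (f : F ⟶ F') (hf : ∀ K, Function.Bijective (f.hom.app K)) :
    IsIso f := by
  have h1 : ∀ K, IsIso (f.hom.app K) := fun K =>
    (ConcreteCategory.isIso_iff_bijective (f.hom.app K)).mpr (hf K)
  have h2 : IsIso f.hom := NatIso.isIso_of_isIso_app f.hom
  have h3 : IsIso ((ObjectProperty.ι _).map f) := h2
  exact isIso_of_fully_faithful (ObjectProperty.ι _) f

theorem bijective_of_isIso (f : F ⟶ F') [IsIso f] (K : BisetCat.{u, w} R p) :
    Function.Bijective (f.hom.app K) := by
  have h2 : IsIso f.hom := inferInstanceAs (IsIso ((ObjectProperty.ι _).map f))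
  exact (ConcreteCategory.isIso_iff_bijective (f.hom.app K)).mp inferInstance

/-- A functor is simple if it is nonzero and has no proper nonzero stable family of submodules. -/
theorem simple_of_stable {G : BisetCat.{u, w} R p} [Nontrivial (F.obj.obj G)]
    (h : ∀ N, IsStable F N → ∀ K, N K ≠ ⊥ → ∀ L, N L = ⊤) : Simple F where
  mono_isIso_iff_nonzero {Y} f _ := by
    constructor
    · rintro hf rfl
      obtain ⟨z, hz⟩ := exists_ne (0 : F.obj.obj G)
      obtain ⟨y, hy⟩ := (bijective_of_isIso (0 : Y ⟶ F) G).2 z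
      exact hz hy.symm
    · intro hf
      have hN : IsStable F fun K => LinearMap.range (f.hom.app K).hom := by
        rintro K L x _ ⟨y, rfl⟩
        exact ⟨Y.obj.map x y, naturality_apply f x y⟩
      have hex : ∃ K z, f.hom.app K z ≠ 0 := by
        by_contra! hcon
        exact hf (hom_eq_zero_iff.mpr hcon)
      obtain ⟨K, z, hz⟩ := hex
      have hK : LinearMap.range (f.hom.app K).hom ≠ ⊥ := fun hb =>
        hz ((Submodule.mem_bot R).mp (hb ▸ ⟨z, rfl⟩))
      exact isIso_of_bijective f fun L =>
        ⟨injective_of_mono f L, LinearMap.range_eq_top.mp (h _ hN K hK L)⟩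

/-- The inclusion of the associated subfunctor is a nonzero monomorphism into a simple object, hence
an isomorphism. -/
theorem IsStable.eq_top [Simple F] {N : ∀ K, Submodule R (F.obj.obj K)} (hN : IsStable F N)
    {K : BisetCat.{u, w} R p} (hK : N K ≠ ⊥) (L : BisetCat.{u, w} R p) : N L = ⊤ := by
  have : Mono (subfunctorι hN) := mono_of_injective _ fun K => Subtype.val_injective
  have h0 : subfunctorι hN ≠ 0 := fun h => hK ((Submodule.eq_bot_iff _).mpr fun z hz =>
    hom_eq_zero_iff.mp h K ⟨z, hz⟩)
  have : IsIso (subfunctorι hN) := isIso_of_mono_of_nonzero h0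
  refine (Submodule.eq_top_iff').mpr fun z => ?_
  obtain ⟨y, rfl⟩ := (bijective_of_isIso (subfunctorι hN) L).2 z
  exact y.2

theorem exists_nontrivial [Simple F] : ∃ K, Nontrivial (F.obj.obj K) := by
  by_contra! h
  refine id_nonzero F (hom_eq_zero_iff.mpr fun K z => ?_)
  exact (h K).elim _ _

/-- The action of `End(G)` on the value of a functor at `G`. -/
noncomputable def action (F : BisetFunctor.{u, w} R p) (G : BisetCat.{u, w} R p) :
    End G →ₐ[R] Module.End R (F.obj.obj G) :=
  AlgHom.ofLinearMap
    { toFun := fun x => (F.obj.map x.asHom).hom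
      map_add' := fun x y => congrArg (·.hom) (F.map_add x.asHom y.asHom)
      map_smul' := fun r x => congrArg (·.hom) (F.map_smul r x.asHom) }
    (congrArg (·.hom) (F.obj.map_id G))
    (fun x y => congrArg (·.hom) (F.obj.map_comp y.asHom x.asHom))

/-- The elements which all morphisms to `G` send into `W` form a stable family. -/
theorem isStable_iInf_comap (F : BisetFunctor.{u, w} R p) {G : BisetCat.{u, w} R p}
    (W : Submodule R (F.obj.obj G)) :
    IsStable F fun K => ⨅ y : K ⟶ G, W.comap (F.obj.map y).hom := by
  intro K L f z hz
  simp only [Submodule.mem_iInf, Submodule.mem_comap] at hz ⊢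
  intro y
  have h := hz (f ≫ y)
  rwa [F.obj.map_comp] at h

/-- In a simple functor which is nonzero at `G`, an element killed by all morphisms to `G`
vanishes. -/
theorem eq_zero_of_map_eq_zero [Simple F] {G : BisetCat.{u, w} R p} [Nontrivial (F.obj.obj G)]
    {K : BisetCat.{u, w} R p} {z : F.obj.obj K} (hz : ∀ y : K ⟶ G, F.obj.map y z = 0) : z = 0 := by
  by_contra h
  have hz' : z ∈ ⨅ y : K ⟶ G, (⊥ : Submodule R (F.obj.obj G)).comap (F.obj.map y).hom := by
    simp only [Submodule.mem_iInf, Submodule.mem_comap, Submodule.mem_bot]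
    exact hz
  -- The elements killed by every morphism to `G` form a stable family. It contains `z ≠ 0`, so it
  -- is all of `F`; at `G` the identity morphism then kills everything.
  have hG := (F.isStable_iInf_comap ⊥).eq_top (K := K)
    (fun hb => h ((Submodule.mem_bot R).mp (hb ▸ hz'))) G
  obtain ⟨v, hv⟩ := exists_ne (0 : F.obj.obj G)
  have hv' : v ∈ ⨅ y : G ⟶ G, (⊥ : Submodule R (F.obj.obj G)).comap (F.obj.map y).hom :=
    hG ▸ Submodule.mem_top
  simp only [Submodule.mem_iInf, Submodule.mem_comap, Submodule.mem_bot] at hv'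
  have h1 := hv' (𝟙 G)
  rw [F.obj.map_id] at h1
  exact hv h1

/-- A submodule of the value at `G` of a simple functor which is stable under `End(G)` is `0` or
everything. -/
theorem eq_top_of_action_mem [Simple F] {G : BisetCat.{u, w} R p}
    {W : Submodule R (F.obj.obj G)} (hW : ∀ (x : G ⟶ G), ∀ v ∈ W, F.obj.map x v ∈ W)
    (h0 : W ≠ ⊥) : W = ⊤ := by
  -- The stable family attached to `W` has value exactly `W` at `G`: the identity gives one
  -- inclusion, invariance of `W` the other.
  have hG : (⨅ y : G ⟶ G, W.comap (F.obj.map y).hom) = W := by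
    refine le_antisymm (fun v hv => ?_) (fun v hv => ?_)
    · have h1 := (Submodule.mem_iInf _).mp hv (𝟙 G)
      rwa [Submodule.mem_comap, F.obj.map_id] at h1
    · exact (Submodule.mem_iInf _).mpr fun y => hW y v hv
  exact hG.symm.trans ((F.isStable_iInf_comap W).eq_top (hG.symm ▸ h0) G)

end BisetFunctor

end SimpleFunctors

end PBifree

/-! ### The functors `S_{G,V}`: value at `G`, simplicity and mapping property. -/

namespace PBifree

section FunctorS

variable {R : Type w} [CommRing R] {p : ℕ} [Fact p.Prime]

variable (G : BisetCat.{u, w} R p) {V : Type (max (u + 1) w)} [AddCommGroup V] [Module R V]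
  (ρ : End G →ₐ[R] Module.End R V)

namespace FunctorS

/-- The class of `x ⊗ v` in `S_{G,V}(K)`. -/
noncomputable def mk {K : BisetCat.{u, w} R p} (x : G ⟶ K) : V →ₗ[R] (functorS G ρ).obj.obj K :=
  (subJ G ρ K).mkQ ∘ₗ (balancedRel G ρ K).mkQ ∘ₗ TensorProduct.mk R (G ⟶ K) V x

variable {G ρ} in
theorem mem_of_mk_mem {K : BisetCat.{u, w} R p} {N : Submodule R ((functorS G ρ).obj.obj K)}
    (h : ∀ (x : G ⟶ K) (v : V), mk G ρ x v ∈ N) (z : (functorS G ρ).obj.obj K) : z ∈ N := by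
  obtain ⟨z, rfl⟩ := (subJ G ρ K).mkQ_surjective z
  obtain ⟨z, rfl⟩ := (balancedRel G ρ K).mkQ_surjective z
  let q : (G ⟶ K) ⊗[R] V →ₗ[R] (functorS G ρ).obj.obj K :=
    (subJ G ρ K).mkQ ∘ₗ (balancedRel G ρ K).mkQ
  change z ∈ N.comap q
  induction z using TensorProduct.induction_on with
  | zero => exact Submodule.zero_mem _
  | tmul x v => exact h x v
  | add a b ha hb => exact Submodule.add_mem _ ha hb

variable {G ρ} in
theorem linearMap_ext {K : BisetCat.{u, w} R p} {M : Type*} [AddCommGroup M] [Module R M]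
    {f g : (functorS G ρ).obj.obj K →ₗ[R] M}
    (h : ∀ (x : G ⟶ K) (v : V), f (mk G ρ x v) = g (mk G ρ x v)) : f = g :=
  LinearMap.ext fun z => mem_of_mk_mem (N := LinearMap.eqLocus f g) h z

theorem map_mk {K L : BisetCat.{u, w} R p} (x : G ⟶ K) (f : K ⟶ L) (v : V) :
    (functorS G ρ).obj.map f (mk G ρ x v) = mk G ρ (x ≫ f) v := rfl

theorem mk_comp {K : BisetCat.{u, w} R p} (e : G ⟶ G) (x : G ⟶ K) (v : V) :
    mk G ρ (e ≫ x) v = mk G ρ x (ρ e v) := by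
  refine congrArg (subJ G ρ K).mkQ ((Submodule.Quotient.eq _).mpr ?_)
  exact Submodule.subset_span ⟨x, e, v, rfl⟩

/-- The map `S_{G,V}(K) → V`, `x ⊗ v ↦ (y ∘ x) v`. -/
noncomputable def eval {K : BisetCat.{u, w} R p} (y : K ⟶ G) :
    (functorS G ρ).obj.obj K →ₗ[R] V :=
  (subJ G ρ K).liftQ (evalL G ρ y) (iInf_le _ y)

theorem eval_mk {K : BisetCat.{u, w} R p} (x : G ⟶ K) (y : K ⟶ G) (v : V) :
    eval G ρ y (mk G ρ x v) = ρ (x ≫ y : G ⟶ G) v := rfl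

variable {G ρ} in
theorem eq_zero_of_eval_eq_zero {K : BisetCat.{u, w} R p} {z : (functorS G ρ).obj.obj K}
    (h : ∀ y : K ⟶ G, eval G ρ y z = 0) : z = 0 := by
  obtain ⟨z, rfl⟩ := (subJ G ρ K).mkQ_surjective z
  exact (Submodule.Quotient.mk_eq_zero _).mpr ((Submodule.mem_iInf _).mpr h)

/-- Since `y ∘ x` is an endomorphism of `G`, it can be moved across the tensor product. So, once `V`
is identified with `S_{G,V}(G)`, the map `eval y` is the action of `y`. -/
theorem mk_id_eval {K : BisetCat.{u, w} R p} (y : K ⟶ G) (z : (functorS G ρ).obj.obj K) :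
    mk G ρ (𝟙 G) (eval G ρ y z) = (functorS G ρ).obj.map y z := by
  have h : mk G ρ (𝟙 G) ∘ₗ eval G ρ y = ((functorS G ρ).obj.map y).hom :=
    linearMap_ext fun x v => by
      rw [LinearMap.comp_apply, eval_mk, ← mk_comp, Category.comp_id]
      rfl
  exact DFunLike.congr_fun h z

/-- The isomorphism `V ≃ S_{G,V}(G)`. -/
noncomputable def unitEquiv : V ≃ₗ[R] (functorS G ρ).obj.obj G :=
  LinearEquiv.ofLinearMap (mk G ρ (𝟙 G)) (eval G ρ (𝟙 G))
    (LinearMap.ext fun z => by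
      rw [LinearMap.comp_apply, mk_id_eval, CategoryTheory.Functor.map_id]
      rfl)
    (LinearMap.ext fun v => by
      rw [LinearMap.comp_apply, eval_mk, Category.comp_id]
      exact DFunLike.congr_fun (map_one ρ) v)

theorem map_unitEquiv {K : BisetCat.{u, w} R p} (x : G ⟶ K) (v : V) :
    (functorS G ρ).obj.map x (unitEquiv G ρ v) = mk G ρ x v := by
  refine (map_mk G ρ (𝟙 G) x v).trans ?_
  rw [Category.id_comp]

theorem map_unitEquiv_end (x : G ⟶ G) (v : V) :
    (functorS G ρ).obj.map x (unitEquiv G ρ v) = unitEquiv G ρ (ρ x v) := by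
  rw [map_unitEquiv]
  refine Eq.trans ?_ (mk_comp G ρ x (𝟙 G) v)
  rw [Category.comp_id]

variable {G ρ} in
/-- `S_{G,V}` is simple if `V` is a simple `End(G)`-module. -/
theorem simple [Nontrivial V]
    (hV : ∀ W : Submodule R V, (∀ x, ∀ v ∈ W, ρ x v ∈ W) → W ≠ ⊥ → W = ⊤) :
    Simple (functorS G ρ) := by
  have : Nontrivial ((functorS G ρ).obj.obj G) := (unitEquiv G ρ).symm.toEquiv.nontrivial
  refine BisetFunctor.simple_of_stable (G := G) fun N hN K hK L => ?_
  obtain ⟨z, hz, hz0⟩ := (N K).exists_mem_ne_zero_of_ne_bot hK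
  obtain ⟨y, hy⟩ : ∃ y : K ⟶ G, eval G ρ y z ≠ 0 := by
    by_contra! h
    exact hz0 (eq_zero_of_eval_eq_zero h)
  -- Read in `V`, the submodule `N G` is invariant under `End G` and contains `eval y z ≠ 0`.
  have hW : (N G).comap (unitEquiv G ρ).toLinearMap = ⊤ := by
    refine hV _ (fun x v hv => ?_) fun hb => hy ?_
    · rw [Submodule.mem_comap, LinearEquiv.coe_coe, ← map_unitEquiv_end]
      exact hN _ _ hv
    · rw [← Submodule.mem_bot R, ← hb]
      have h := hN y z hz
      rw [← mk_id_eval] at h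
      exact h
  -- The functor is generated by its value at `G`, so `N G = ⊤` forces `N L = ⊤`.
  refine (Submodule.eq_top_iff').mpr (mem_of_mk_mem fun x v => ?_)
  rw [← map_unitEquiv]
  refine hN x _ ?_
  have : v ∈ (N G).comap (unitEquiv G ρ).toLinearMap := hW ▸ Submodule.mem_top
  exact this

variable {G ρ} in
-- If every endomorphism of `G` through `K` acted by zero on `V`, all evaluations would vanish, and
-- so would `S_{G,V}(K)`.
theorem exists_apply_comp_ne_zero {K : BisetCat.{u, w} R p}
    [Nontrivial ((functorS G ρ).obj.obj K)] :
    ∃ (x : G ⟶ K) (y : K ⟶ G), ρ (x ≫ y : G ⟶ G) ≠ 0 := by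
  by_contra! h
  obtain ⟨z, hz⟩ := exists_ne (0 : (functorS G ρ).obj.obj K)
  refine hz (eq_zero_of_eval_eq_zero fun y => ?_)
  have h0 : eval G ρ y = 0 := linearMap_ext fun x v => by rw [eval_mk, h]; rfl
  rw [h0, LinearMap.zero_apply]

section Universal

variable {F : BisetFunctor.{u, w} R p} (u : V →ₗ[R] F.obj.obj G)
  (hu : ∀ (x : G ⟶ G) (v : V), F.obj.map x (u v) = u (ρ x v))

/-- The map `L_{G,V}(K) → F(K)`, `x ⊗ v ↦ F(x)(u(v))`. -/
noncomputable def liftL (K : BisetCat.{u, w} R p) : (functorL G ρ).obj K →ₗ[R] F.obj.obj K :=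
  (balancedRel G ρ K).liftQ
    (TensorProduct.lift
      { toFun := fun x => (F.obj.map x).hom ∘ₗ u
        map_add' := fun x x' => by rw [F.map_add]; rfl
        map_smul' := fun r x => by rw [F.map_smul]; rfl }) (by
      rw [balancedRel, Submodule.span_le]
      rintro _ ⟨x, e, v, rfl⟩
      change TensorProduct.lift _ _ = 0
      rw [map_sub, TensorProduct.lift.tmul, TensorProduct.lift.tmul, sub_eq_zero]
      change F.obj.map (e.asHom ≫ x) (u v) = F.obj.map x (u (ρ e v))
      rw [F.obj.map_comp, ← hu]
      rfl)

/-- Consequently an element of `J_{G,V}` has an image in `F` that every morphism to `G` kills. If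
such elements of `F` are zero, `liftL` passes to `S_{G,V}`. -/
theorem map_liftL {K : BisetCat.{u, w} R p} (y : K ⟶ G) (z : (functorL G ρ).obj K) :
    F.obj.map y (liftL G ρ u hu K z) = u (evalL G ρ y z) := by
  have h : (F.obj.map y).hom ∘ₗ liftL G ρ u hu K = u ∘ₗ evalL G ρ y := by
    apply Submodule.linearMap_qext
    apply TensorProduct.ext'
    intro x v
    change F.obj.map y (F.obj.map x (u v)) = u (ρ (x ≫ y : G ⟶ G) v)
    rw [← hu, F.obj.map_comp]
    rfl
  exact DFunLike.congr_fun h z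

variable (hF : ∀ (K : BisetCat.{u, w} R p) (z : F.obj.obj K),
  (∀ y : K ⟶ G, F.obj.map y z = 0) → z = 0)

/-- The natural transformation `S_{G,V} → F`, `x ⊗ v ↦ F(x)(u(v))`. -/
noncomputable def lift : functorS G ρ ⟶ F where
  hom :=
    { app := fun K => ModuleCat.ofHom ((subJ G ρ K).liftQ (liftL G ρ u hu K) fun z hz =>
        hF K _ fun y => by
          rw [map_liftL, show evalL G ρ y z = 0 from (Submodule.mem_iInf _).mp hz y, map_zero])
      naturality := fun K L f => ModuleCat.hom_ext (linearMap_ext fun x v => by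
        change F.obj.map (x ≫ f) (u v) = F.obj.map f (F.obj.map x (u v))
        rw [F.obj.map_comp]
        rfl) }

theorem lift_unitEquiv (v : V) : (lift G ρ u hu hF).hom.app G (unitEquiv G ρ v) = u v := by
  change F.obj.map (𝟙 G) (u v) = u v
  rw [F.obj.map_id]
  rfl

theorem map_lift {K : BisetCat.{u, w} R p} (y : K ⟶ G) (z : (functorS G ρ).obj.obj K) :
    F.obj.map y ((lift G ρ u hu hF).hom.app K z) = u (eval G ρ y z) := by
  obtain ⟨z, rfl⟩ := (subJ G ρ K).mkQ_surjective z
  exact map_liftL G ρ u hu y z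

end Universal

variable {G ρ} in
/-- A simple functor whose value at `G` is isomorphic to `V ≠ 0` is isomorphic to `S_{G,V}`. -/
theorem nonempty_iso [Nontrivial V] {F : BisetFunctor.{u, w} R p} [Simple F]
    (u : V ≃ₗ[R] F.obj.obj G) (hu : ∀ (x : G ⟶ G) (v : V), F.obj.map x (u v) = u (ρ x v)) :
    Nonempty (F ≅ functorS G ρ) := by
  have : Nontrivial (F.obj.obj G) := u.symm.toEquiv.nontrivial
  have hF : ∀ (K : BisetCat.{u, w} R p) (z : F.obj.obj K),
      (∀ y : K ⟶ G, F.obj.map y z = 0) → z = 0 := fun K z =>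
    BisetFunctor.eq_zero_of_map_eq_zero
  let τ := lift G ρ u.toLinearMap hu hF
  -- If `τ` kills `z`, then `u (eval y z) = F(y)(τ z) = 0` for every `y`; as `u` is injective, all
  -- evaluations of `z` vanish.
  have hmono : Mono τ := BisetFunctor.mono_of_injective τ fun K =>
    (injective_iff_map_eq_zero (τ.hom.app K).hom).mpr fun z hz =>
      eq_zero_of_eval_eq_zero fun y => u.map_eq_zero_iff.mp (by
        refine (map_lift G ρ u.toLinearMap hu hF y z).symm.trans ?_
        rw [show (lift G ρ u.toLinearMap hu hF).hom.app K z = 0 from hz, map_zero])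
  have hne : τ ≠ 0 := by
    intro h0
    obtain ⟨v, hv⟩ := exists_ne (0 : V)
    refine hv (u.map_eq_zero_iff.mp ((lift_unitEquiv G ρ u.toLinearMap hu hF v).symm.trans ?_))
    exact BisetFunctor.hom_eq_zero_iff.mp h0 G _
  have : IsIso τ := isIso_of_mono_of_nonzero hne
  exact ⟨(asIso τ).symm⟩

end FunctorS

end FunctorS

end PBifree

/-! ### Classification of the simple functors. -/

namespace PBifree

section Classification

variable {R : Type w} [CommRing R] {p : ℕ} [Fact p.Prime]

open BisetCat

section Inflate

variable (G : BisetCat.{u, w} R p) (V : Type (max (u + 1) w)) [AddCommGroup V] [Module R V]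
  [Module (MonoidAlgebra R (Out G.carrier)) V]
  [IsScalarTower R (MonoidAlgebra R (Out G.carrier)) V]

theorem inflate_apply (x : G ⟶ G) (v : V) :
    inflate (essentialEquiv G) V x v =
      essentialEquiv G (Ideal.Quotient.mk (essentialIdeal G) x) • v := rfl

variable {G} in
theorem exists_essentialEquiv_eq (a : MonoidAlgebra R (Out G.carrier)) :
    ∃ x : G ⟶ G, essentialEquiv G (Ideal.Quotient.mk (essentialIdeal G) x) = a := by
  obtain ⟨z, rfl⟩ := (essentialEquiv G).surjective a
  obtain ⟨x, rfl⟩ := Ideal.Quotient.mk_surjective z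
  exact ⟨x, rfl⟩

variable {G} in
theorem inflate_eq_zero {x : G ⟶ G} (hx : x ∈ factoring G G) :
    inflate (essentialEquiv G) V x = 0 := by
  ext v
  rw [inflate_apply, Ideal.Quotient.eq_zero_iff_mem.mpr (mem_essentialIdeal.mpr hx), map_zero,
    zero_smul]
  rfl

/-- `End G` maps onto `R Out(G)`, so a subspace of `V` invariant under `End G` is an `R
Out(G)`-submodule. -/
theorem simple_functorS_inflate [IsSimpleModule (MonoidAlgebra R (Out G.carrier)) V] :
    Simple (functorS G (inflate (essentialEquiv G) V)) := by
  have : Nontrivial V := IsSimpleModule.nontrivial (MonoidAlgebra R (Out G.carrier)) V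
  refine FunctorS.simple fun W hW h0 => ?_
  let W' : Submodule (MonoidAlgebra R (Out G.carrier)) V :=
    { W with
      smul_mem' := fun a v hv => by
        obtain ⟨x, rfl⟩ := exists_essentialEquiv_eq a
        exact hW x v hv }
  rcases eq_bot_or_eq_top W' with h | h
  · refine absurd ((Submodule.eq_bot_iff _).mpr fun v hv => ?_) h0
    have : v ∈ W' := hv
    rwa [h, Submodule.mem_bot] at this
  · refine (Submodule.eq_top_iff').mpr fun v => ?_
    have : v ∈ W' := h ▸ Submodule.mem_top
    exact this

variable {G} in
-- Some endomorphism of `G` through `K` acts nontrivially on `V`, whereas those through smaller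
-- groups lie in the essential ideal and act by zero.
theorem card_le_of_nontrivial {K : BisetCat.{u, w} R p}
    [Nontrivial ((functorS G (inflate (essentialEquiv G) V)).obj.obj K)] :
    Nat.card G.carrier ≤ Nat.card K.carrier := by
  obtain ⟨x, y, hxy⟩ := FunctorS.exists_apply_comp_ne_zero
    (G := G) (ρ := inflate (essentialEquiv G) V) (K := K)
  by_contra! h
  exact hxy (inflate_eq_zero V (Submodule.subset_span ⟨K, x, y, h, rfl⟩))

variable {G} in
-- Without an isomorphism, every morphism `G ⟶ K` would factor, up to linear combination, through
-- groups smaller than `G`, and all composites `G ⟶ K ⟶ G` would act by zero.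
theorem nonempty_mulEquiv_of_nontrivial {K : BisetCat.{u, w} R p}
    (hc : Nat.card G.carrier = Nat.card K.carrier)
    [Nontrivial ((functorS G (inflate (essentialEquiv G) V)).obj.obj K)] :
    Nonempty (G.carrier ≃* K.carrier) := by
  obtain ⟨x, y, hxy⟩ := FunctorS.exists_apply_comp_ne_zero
    (G := G) (ρ := inflate (essentialEquiv G) V) (K := K)
  by_contra h
  have := not_nonempty_iff.mp h
  have hx : x ∈ factoring G K := factoring_eq_top_of_isEmpty hc ▸ Submodule.mem_top
  exact hxy (inflate_eq_zero V (comp_mem_factoring hx y))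

end Inflate

/-- Every simple functor is isomorphic to some `S_{G,V}`. -/
theorem exists_iso_functorS (F : BisetFunctor.{u, w} R p) [Simple F] :
    ∃ (G : BisetCat.{u, w} R p) (V : Type (max (u + 1) w)) (_ : AddCommGroup V)
      (_ : Module R V) (_ : Module (MonoidAlgebra R (Out G.carrier)) V)
      (_ : IsScalarTower R (MonoidAlgebra R (Out G.carrier)) V),
      IsSimpleModule (MonoidAlgebra R (Out G.carrier)) V ∧
        Nonempty (F ≅ functorS G (inflate (essentialEquiv G) V)) := by
  classical
  have hex : ∃ (n : ℕ) (G : BisetCat.{u, w} R p), Nat.card G.carrier = n ∧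
      Nontrivial (F.obj.obj G) := by
    obtain ⟨G, hG⟩ := BisetFunctor.exists_nontrivial (F := F)
    exact ⟨_, G, rfl, hG⟩
  -- `G` has the least order among the groups on which `F` does not vanish.
  obtain ⟨G, hG, hnt⟩ := Nat.find_spec hex
  have hmin : ∀ K : BisetCat.{u, w} R p, Nat.card K.carrier < Nat.card G.carrier →
      Subsingleton (F.obj.obj K) := by
    intro K hK
    by_contra h
    exact Nat.find_min hex (hG ▸ hK) ⟨K, rfl, not_subsingleton_iff_nontrivial.mp h⟩
  -- A morphism through a smaller group passes through a zero value of `F`, so `F(G)` is a module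
  -- over the essential algebra, hence over `R Out(G)`.
  have hker : ∀ x : End G, x ∈ essentialIdeal G → F.action G x = 0 := by
    intro x hx
    have hle : factoring G G ≤ LinearMap.ker (F.action G).toLinearMap := by
      refine Submodule.span_le.mpr ?_
      rintro _ ⟨K, a, b, hK, rfl⟩
      have := hmin K hK
      refine LinearMap.ext fun v => ?_
      change F.obj.map (a ≫ b) v = 0
      have h0 : F.obj.map a v = 0 := Subsingleton.elim _ _
      rw [F.map_comp_apply, h0, map_zero]
    exact hle hx
  let α : MonoidAlgebra R (Out G.carrier) →ₐ[R] Module.End R (F.obj.obj G) :=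
    (Ideal.Quotient.liftₐ (essentialIdeal G) (F.action G) hker).comp
      (essentialEquiv G).symm.toAlgHom
  have hα : ∀ x : G ⟶ G, α (essentialEquiv G (Ideal.Quotient.mk (essentialIdeal G) x)) =
      (F.obj.map x).hom := by
    intro x
    change Ideal.Quotient.liftₐ (essentialIdeal G) (F.action G) hker
      ((essentialEquiv G).symm (essentialEquiv G _)) = _
    rw [AlgEquiv.symm_apply_apply]
    rfl
  let _ : Module (MonoidAlgebra R (Out G.carrier)) (F.obj.obj G) :=
    Module.compHom (F.obj.obj G) α.toRingHom
  have hsmul : ∀ (a : MonoidAlgebra R (Out G.carrier)) (v : F.obj.obj G), a • v = α a v :=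
    fun _ _ => rfl
  have : IsScalarTower R (MonoidAlgebra R (Out G.carrier)) (F.obj.obj G) :=
    ⟨fun r a v => by rw [hsmul, hsmul, map_smul]; rfl⟩
  refine ⟨G, F.obj.obj G, inferInstance, inferInstance, inferInstance, inferInstance, ?_, ?_⟩
  · refine { eq_bot_or_eq_top := fun W => ?_ }
    by_cases h0 : W = ⊥
    · exact Or.inl h0
    · right
      have hW : W.restrictScalars R = ⊤ := by
        refine BisetFunctor.eq_top_of_action_mem (fun x v hv => ?_) fun hb =>
          h0 ((Submodule.restrictScalars_eq_bot_iff R _ _).mp hb)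
        have h := W.smul_mem (essentialEquiv G (Ideal.Quotient.mk (essentialIdeal G) x)) hv
        rw [hsmul, hα] at h
        exact h
      exact (Submodule.restrictScalars_eq_top_iff R _ _).mp hW
  · refine FunctorS.nonempty_iso (LinearEquiv.refl R _) fun x v => ?_
    rw [inflate_apply, hsmul, hα]
    rfl

variable {G H : BisetCat.{u, w} R p} {V : Type (max (u + 1) w)} [AddCommGroup V] [Module R V]
  [Module (MonoidAlgebra R (Out G.carrier)) V]
  [IsScalarTower R (MonoidAlgebra R (Out G.carrier)) V]
  {W : Type (max (u + 1) w)} [AddCommGroup W] [Module R W]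
  [Module (MonoidAlgebra R (Out H.carrier)) W]
  [IsScalarTower R (MonoidAlgebra R (Out H.carrier)) W]

/-- Let `F = S_{H,W}`. The isomorphism `i` of objects given by `f` yields `V ≅ W ≅ F(H) ≅ F(G)`, and
`FunctorS.nonempty_iso` applies once this is shown to respect `End G`. -/
theorem nonempty_iso_of_equiv [IsSimpleModule (MonoidAlgebra R (Out G.carrier)) V]
    [IsSimpleModule (MonoidAlgebra R (Out H.carrier)) W]
    (f : G.carrier ≃* H.carrier) (t : V ≃ₗ[R] W)
    (ht : ∀ (a : MonoidAlgebra R (Out G.carrier)) (v : V),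
      t (a • v) = MonoidAlgebra.domCongr R R (outCongr f) a • t v) :
    Nonempty (functorS G (inflate (essentialEquiv G) V) ≅
      functorS H (inflate (essentialEquiv H) W)) := by
  have := IsSimpleModule.nontrivial (MonoidAlgebra R (Out G.carrier)) V
  have := simple_functorS_inflate H W
  set F := functorS H (inflate (essentialEquiv H) W) with hFdef
  let i : G ≅ H := isoOfMulEquiv f
  let u : V ≃ₗ[R] F.obj.obj G :=
    t ≪≫ₗ FunctorS.unitEquiv H (inflate (essentialEquiv H) W) ≪≫ₗ
      (F.obj.mapIso i.symm).toLinearEquiv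
  have hu' : ∀ v, u v = F.obj.map i.inv (FunctorS.unitEquiv H _ (t v)) := fun _ => rfl
  obtain ⟨j⟩ := FunctorS.nonempty_iso (G := G) (ρ := inflate (essentialEquiv G) V) u fun x v => by
    -- Acting by `x` on `F(G)` corresponds to acting by its conjugate under `i` on `F(H)`, and
    -- `essentialEquiv_conj` identifies that conjugate in `R Out(H)`.
    have hx : i.inv ≫ x = (i.inv ≫ x ≫ i.hom) ≫ i.inv := by simp
    have h1 : F.obj.map x (F.obj.map i.inv (FunctorS.unitEquiv H _ (t v))) =
        F.obj.map i.inv (F.obj.map (i.inv ≫ x ≫ i.hom) (FunctorS.unitEquiv H _ (t v))) := by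
      rw [← F.map_comp_apply, ← F.map_comp_apply, hx]
    rw [hu', hu', h1, FunctorS.map_unitEquiv_end, inflate_apply, inflate_apply, ht]
    exact congrArg (fun a => F.obj.map i.inv (FunctorS.unitEquiv H _ (a • t v)))
      (essentialEquiv_conj f x)
  exact ⟨j.symm⟩

/-- Each functor is nonzero at the other's group, so the orders agree and then the groups are
isomorphic. The map `t` is the composite `V ≅ S(G) ≅ T(G) ≅ T(H) ≅ W`. -/
theorem exists_equiv_of_iso [IsSimpleModule (MonoidAlgebra R (Out G.carrier)) V]
    [IsSimpleModule (MonoidAlgebra R (Out H.carrier)) W]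
    (j : functorS G (inflate (essentialEquiv G) V) ≅ functorS H (inflate (essentialEquiv H) W)) :
    ∃ (f : G.carrier ≃* H.carrier) (t : V ≃ₗ[R] W),
      ∀ (a : MonoidAlgebra R (Out G.carrier)) (v : V),
        t (a • v) = MonoidAlgebra.domCongr R R (outCongr f) a • t v := by
  have := IsSimpleModule.nontrivial (MonoidAlgebra R (Out G.carrier)) V
  have := IsSimpleModule.nontrivial (MonoidAlgebra R (Out H.carrier)) W
  set S := functorS G (inflate (essentialEquiv G) V) with hS
  set T := functorS H (inflate (essentialEquiv H) W) with hT
  let φ : ∀ K, S.obj.obj K ≃ₗ[R] T.obj.obj K := fun K =>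
    LinearEquiv.ofBijective (j.hom.hom.app K).hom (BisetFunctor.bijective_of_isIso j.hom K)
  have hSH : Nontrivial (S.obj.obj H) :=
    ((FunctorS.unitEquiv H (inflate (essentialEquiv H) W)).trans (φ H).symm).symm.toEquiv.nontrivial
  have hTG : Nontrivial (T.obj.obj G) :=
    ((FunctorS.unitEquiv G (inflate (essentialEquiv G) V)).trans (φ G)).symm.toEquiv.nontrivial
  have hc : Nat.card G.carrier = Nat.card H.carrier :=
    le_antisymm (card_le_of_nontrivial V) (card_le_of_nontrivial W)
  obtain ⟨f⟩ := nonempty_mulEquiv_of_nontrivial (G := G) (K := H) V hc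
  let i : G ≅ H := isoOfMulEquiv f
  let t : V ≃ₗ[R] W :=
    FunctorS.unitEquiv G (inflate (essentialEquiv G) V) ≪≫ₗ φ G ≪≫ₗ
      (T.obj.mapIso i).toLinearEquiv ≪≫ₗ (FunctorS.unitEquiv H (inflate (essentialEquiv H) W)).symm
  have htu : ∀ v, FunctorS.unitEquiv H (inflate (essentialEquiv H) W) (t v) =
      T.obj.map i.hom (j.hom.hom.app G (FunctorS.unitEquiv G _ v)) := fun v =>
    LinearEquiv.apply_symm_apply (FunctorS.unitEquiv H (inflate (essentialEquiv H) W)) _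
  refine ⟨f, t, fun a v => ?_⟩
  obtain ⟨x, rfl⟩ := exists_essentialEquiv_eq a
  rw [← inflate_apply, ← essentialEquiv_conj]
  refine Eq.trans ?_ (inflate_apply H W (i.inv ≫ x ≫ i.hom) (t v))
  -- Compared inside `T(H)`, both sides become actions of morphisms, and the claim reduces to `x ≫
  -- i.hom = i.hom ≫ (i.inv ≫ x ≫ i.hom)`.
  apply (FunctorS.unitEquiv H (inflate (essentialEquiv H) W)).injective
  rw [htu, ← FunctorS.map_unitEquiv_end, ← FunctorS.map_unitEquiv_end, htu,
    BisetFunctor.naturality_apply]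
  have hx : T.obj.map (x ≫ i.hom) = T.obj.map (i.hom ≫ i.inv ≫ x ≫ i.hom) := by
    rw [i.hom_inv_id_assoc]
  rw [← T.map_comp_apply, hx]
  exact T.map_comp_apply i.hom _ _

end Classification

end PBifree

theorem mainTheorem11 (R : Type w) [CommRing R] (p : ℕ) [Fact p.Prime] :
    -- the essential algebra of `G` is `R Out(G)`, the class of the biset `G` twisted by an
    -- automorphism `a` corresponding to the class of `a` in `Out(G)`
    ∃ e : ∀ G : PBifree.BisetCat.{u, w} R p,
        PBifree.EssentialAlgebra G ≃ₐ[R] MonoidAlgebra R (PBifree.Out G.carrier),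
      (∀ (G : PBifree.BisetCat.{u, w} R p) (a : MulAut G.carrier),
        e G (Ideal.Quotient.mk (PBifree.essentialIdeal G)
            (PBifree.BisetCat.homOfBiset (PBifree.Biset.ofIso p a))) =
          MonoidAlgebra.single (QuotientGroup.mk a) 1) ∧
      -- every `S_{G,V}` with `V` simple is simple
      (∀ (G : PBifree.BisetCat.{u, w} R p) (V : Type (max (u + 1) w)) [AddCommGroup V] [Module R V]
        [Module (MonoidAlgebra R (PBifree.Out G.carrier)) V]
        [IsScalarTower R (MonoidAlgebra R (PBifree.Out G.carrier)) V],
        IsSimpleModule (MonoidAlgebra R (PBifree.Out G.carrier)) V →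
          Simple (PBifree.functorS G (PBifree.inflate (e G) V))) ∧
      -- every simple functor is isomorphic to some `S_{G,V}` with `V` simple
      (∀ F : PBifree.BisetFunctor.{u, w} R p, Simple F →
        ∃ (G : PBifree.BisetCat.{u, w} R p) (V : Type (max (u + 1) w)) (_ : AddCommGroup V)
          (_ : Module R V) (_ : Module (MonoidAlgebra R (PBifree.Out G.carrier)) V)
          (_ : IsScalarTower R (MonoidAlgebra R (PBifree.Out G.carrier)) V),
          IsSimpleModule (MonoidAlgebra R (PBifree.Out G.carrier)) V ∧
            Nonempty (F ≅ PBifree.functorS G (PBifree.inflate (e G) V))) ∧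
      -- `S_{G,V} ≅ S_{H,W}` if and only if the pairs `(G, V)` and `(H, W)` are isomorphic
      (∀ (G H : PBifree.BisetCat.{u, w} R p)
        (V : Type (max (u + 1) w)) [AddCommGroup V] [Module R V]
        [Module (MonoidAlgebra R (PBifree.Out G.carrier)) V]
        [IsScalarTower R (MonoidAlgebra R (PBifree.Out G.carrier)) V]
        (W : Type (max (u + 1) w)) [AddCommGroup W] [Module R W]
        [Module (MonoidAlgebra R (PBifree.Out H.carrier)) W]
        [IsScalarTower R (MonoidAlgebra R (PBifree.Out H.carrier)) W],
        IsSimpleModule (MonoidAlgebra R (PBifree.Out G.carrier)) V →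
        IsSimpleModule (MonoidAlgebra R (PBifree.Out H.carrier)) W →
          (Nonempty (PBifree.functorS G (PBifree.inflate (e G) V) ≅
              PBifree.functorS H (PBifree.inflate (e H) W)) ↔
            ∃ (f : G.carrier ≃* H.carrier) (t : V ≃ₗ[R] W),
              ∀ (a : MonoidAlgebra R (PBifree.Out G.carrier)) (v : V),
                t (a • v) = MonoidAlgebra.domCongr R R (PBifree.outCongr f) a • t v)) := by
  refine ⟨PBifree.essentialEquiv, fun G a => PBifree.essentialEquiv_homOfIso G a, ?_, ?_, ?_⟩
  · intro G V _ _ _ _ hV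
    exact PBifree.simple_functorS_inflate G V
  · intro F hF
    exact PBifree.exists_iso_functorS F
  · intro G H V _ _ _ _ W _ _ _ _ hV hW
    exact ⟨fun ⟨j⟩ => PBifree.exists_equiv_of_iso j,
      fun ⟨f, t, ht⟩ => PBifree.nonempty_iso_of_equiv f t ht⟩
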